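/- Let $K$ be an arbitrary field. Let $L/L_0$ be a finite separable extension of fields containing $K$. It is *defined over* a field $E_0$, $K\subseteq E_0\subseteq L_0$, if there is a field $E$ with $E_0\subseteq E\subseteq L$, $[E:E_0]=[L:L_0]$ and $L=EL_0$; the essential dimension $\mathrm{ed}_K(L/L_0)$ is the minimum of $\mathrm{trdeg}_K E_0$ over all $E_0$ over which $L/L_0$ is defined. For a finite group $G$ put $\mathrm{ed}_K(G)=\mathrm{ed}_K\bigl(K(V)/K(V)^G\bigr)$, where $V$ is a faithful finite-dimensional representation of $G$ over $K$ and $K(V)$ is the function field of the affine space $V$; this number does not depend on $V$, and we take for $V$ the regular representation, so that $K(V)=K(x_g : g\in G)$ with $h\cdot x_g=x_{hg}$. Let $A_n$ be the alternating group of degree $n\ge 0$. **Theorem 5.6.** 1. If $\operatorname{char} K\neq 2$, then - $\mathrm{ed}_K(A_3)=1$ and $\mathrm{ed}_K(A_4)=\mathrm{ed}_K(A_5)=2$; - $\mathrm{ed}_K(A_{n+4})\ge \mathrm{ed}_K(A_n)+2$ for every $n\ge 4$; - $\mathrm{ed}_K(A_n)\ge 2\lfloor n/4\rfloor$ for every $n$.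 2. If $K$ contains the field $\mathbf F_4$ with four elements, then $\mathrm{ed}_K(A_{n+3})\ge \mathrm{ed}_K(A_n)+1$ for every $n\neq 4$. 3. If $\operatorname{char} K=2$, then $\mathrm{ed}_K(A_n)\ge\lfloor n/3\rfloor$ for every $n$. -/

import Mathlib

namespace EssDim

open IntermediateField

/-- Let `L / L₀` be an extension of fields containing `K`.  It is *defined over* the field `E₀`,
`K ⊆ E₀ ⊆ L₀`, if there is a field `E` with `E₀ ⊆ E ⊆ L`, `[E : E₀] = [L : L₀]` and `L = E L₀`.
(`relfinrank E₀ E` is the degree `[E : E₀]`; for a finite extension `L / L₀` the right hand side is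
positive, so the equation of degrees forces `E / E₀` to be finite as well.) -/
def IsDefinedOver (K : Type*) {L : Type*} [Field K] [Field L] [Algebra K L]
    (L₀ E₀ : IntermediateField K L) : Prop :=
  E₀ ≤ L₀ ∧ ∃ E : IntermediateField K L,
    E₀ ≤ E ∧ relfinrank E₀ E = Module.finrank L₀ L ∧ E ⊔ L₀ = ⊤

/-- The essential dimension `ed_K (L / L₀)` of a finite separable extension `L / L₀` of fields
containing `K`: the minimum of `trdeg_K E₀` over all fields `E₀` over which `L / L₀` is defined.
(`E₀ = L₀`, `E = L` is always allowed, so if `L₀` has finite transcendence degree over `K`, the set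
below is not empty and the infimum in `ℕ` is a minimum.) -/
noncomputable def edExt (K : Type*) {L : Type*} [Field K] [Field L] [Algebra K L]
    (L₀ : IntermediateField K L) : ℕ :=
  sInf {d : ℕ | ∃ E₀ : IntermediateField K L,
    IsDefinedOver K L₀ E₀ ∧ Algebra.trdeg K E₀ = (d : Cardinal)}

/-- The function field `K(V)` of the regular representation `V` of `G` over `K`: the field of
rational functions in the variables `x_g`, `g ∈ G`, which are the basis of the dual space of `V`
dual to the basis `G` of `V`. -/
abbrev RegField (K : Type*) [Field K] (G : Type*) : Type _ :=
  FractionRing (MvPolynomial G K)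

/-- The action of `G` on the polynomial ring `K[V] = K[x_g : g ∈ G]` by `h · x_g = x_{hg}`. -/
noncomputable def regPolyAction (K : Type*) [Field K] (G : Type*) [Group G] :
    G →* (MvPolynomial G K ≃ₐ[K] MvPolynomial G K) where
  toFun h := MvPolynomial.renameEquiv K (Equiv.mulLeft h)
  map_one' := by
    apply AlgEquiv.coe_toAlgHom_injective
    apply MvPolynomial.algHom_ext
    intro g
    simp
  map_mul' h₁ h₂ := by
    apply AlgEquiv.coe_toAlgHom_injective
    apply MvPolynomial.algHom_ext
    intro g
    simp [mul_assoc]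

/-- The action of `G` on the function field `K(V) = K(x_g : g ∈ G)` of its regular representation
by `K`-automorphisms, `h · x_g = x_{hg}`. -/
noncomputable def regAction (K : Type*) [Field K] (G : Type*) [Group G] :
    G →* (RegField K G ≃ₐ[K] RegField K G) :=
  (IsFractionRing.fieldEquivOfAlgEquivHom K (RegField K G)).comp (regPolyAction K G)

/-- The fixed field `K(V)^G`. -/
noncomputable def regFixed (K : Type*) [Field K] (G : Type*) [Group G] :
    IntermediateField K (RegField K G) :=
  fixedField (regAction K G).range

/-- The essential dimension `ed_K (G) = ed_K (K(V) / K(V)^G)` of a finite group `G` over a field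
`K`, where `V` is a faithful representation of `G` over `K`.  The right hand side does not depend on
the faithful representation; here `V` is the regular representation. -/
noncomputable def ed (K : Type*) [Field K] (G : Type*) [Group G] [Finite G] : ℕ :=
  edExt K (regFixed K G)

end EssDim

/-! For L = K(V), the essential dimension of G is the least transcendence degree over K of a
G-stable subfield E of L on which G acts faithfully (`Compresses`). Given such an E, Galois theory
shows that L/L^G is defined over E^G. Conversely, if L/L^G is defined over E₀, the algebraic closure
of E₀ in L is stable and faithful.

The lower bounds rest on `ed_add_one_le_ed_prod`: ed(G × C) ≥ ed(G) + 1 if C ≠ 1 is a finite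
subgroup of Kˣ whose order is invertible in K and kills the centre of G, and if every nontrivial
normal subgroup of G has a nontrivial element of order invertible in K. Splitting the variables into
C-eigenvectors embeds L into F((t)), so that C acts on t through a character and G acts on the
coefficients. Let E be a compression for G × C of least transcendence degree. The t-adic valuation
is nontrivial on E, so passing to residues lowers the transcendence degree.

The group G stays faithful on the residues (`compresses_residueField`). An automorphism that fixes
all leading coefficients of E and has finite order invertible in F is the identity on E, by a
telescoping sum over its powers. An element of G that is trivial on residues turns out to be
central, and multiplying it by a suitable element of C makes it fix all leading coefficients.

The residues lie in a field of rational functions in variables permuted freely by G. An equivariant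
Kronecker substitution carries them into the function field of the regular representation of G
(`ed_le_of_compresses_permAction`). The same argument shows that ed is monotone in subgroups.
Partial homomorphisms L → M (residue maps, specializations) are treated through their graphs, as
subalgebras of L × M.

For alternating groups, use A_n × V₄ ⊂ A_{n+4} with C = {±1} twice, and A_n × A_3 ⊂ A_{n+3} with C =
F₄ˣ once. The degrees n = 3 (centre of order 3) and n = 4 (normal 2-subgroup in characteristic 2)
are excluded respectively, and A_6 ⊂ A_7 fills the gap in the inductions. If F₄ is not in K, extend
scalars, which cannot raise ed. The upper bounds come from ratios of differences of three points of
a line and from cross-ratios of five points. -/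

namespace EssDim
open IntermediateField

/-- The intermediate field `E` of `L / K` is stable under the action `ρ` of `G` on `L`, and `G` acts
faithfully on it. -/
structure Compresses {K L G : Type*} [Field K] [Field L] [Algebra K L] [Group G]
    (ρ : G →* (L ≃ₐ[K] L)) (E : IntermediateField K L) : Prop where
  stable : ∀ g, ∀ x ∈ E, ρ g x ∈ E
  faithful : ∀ g, (∀ x ∈ E, ρ g x = x) → g = 1

/-! ### Essential dimension as the least transcendence degree of a compression -/

section Galois

variable {K L G : Type*} [Field K] [Field L] [Algebra K L] [Group G]
  {ρ : G →* (L ≃ₐ[K] L)}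

theorem mem_fixedField_range {x : L} : x ∈ fixedField ρ.range ↔ ∀ g, ρ g x = x := by
  rw [IntermediateField.mem_fixedField_iff]
  simp

theorem trdeg_eq_of_le_of_isAlgebraic {E₀ E : IntermediateField K L} (h : E₀ ≤ E)
    (halg : ∀ x ∈ E, IsAlgebraic E₀ x) : Algebra.trdeg K E = Algebra.trdeg K E₀ := by
  let := (IntermediateField.inclusion h).toRingHom.toAlgebra
  have : IsScalarTower K E₀ E := IsScalarTower.of_algebraMap_eq fun _ ↦ rfl
  have : IsScalarTower E₀ E L := IsScalarTower.of_algebraMap_eq fun _ ↦ rfl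
  have : Algebra.IsAlgebraic E₀ E := ⟨fun x ↦ by
    rw [← isAlgebraic_algebraMap_iff (A := L) (algebraMap E L).injective]
    exact halg _ x.2⟩
  have := _root_.trdeg_add_eq K E₀ (A := E)
  rw [trdeg_eq_zero (R := E₀) (A := E), add_zero] at this
  exact this.symm

theorem isAlgebraic_of_relfinrank_pos {E₀ E : IntermediateField K L} (h : E₀ ≤ E)
    (hpos : 0 < relfinrank E₀ E) {x : L} (hx : x ∈ E) : IsAlgebraic E₀ x := by
  rw [relfinrank_eq_finrank_of_le h] at hpos
  have : FiniteDimensional E₀ (extendScalars h) := Module.finite_of_finrank_pos hpos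
  have := Algebra.IsAlgebraic.isAlgebraic (R := E₀) (⟨x, hx⟩ : extendScalars h)
  exact (isAlgebraic_algebraMap_iff (A := L) (algebraMap (extendScalars h) L).injective).2 this

theorem isGaloisGroup_fixedField (hρ : Function.Injective ρ) :
    letI := MulSemiringAction.compHom L ρ
    IsGaloisGroup G (fixedField ρ.range) L := by
  let := MulSemiringAction.compHom L ρ
  refine
    { faithful := ⟨fun {a b} h ↦ hρ (AlgEquiv.ext h)⟩
      commutes := ⟨fun g x y ↦ ?_⟩
      isInvariant := ⟨fun b hb ↦ ⟨⟨b, mem_fixedField_range.2 hb⟩, rfl⟩⟩ }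
  change ρ g ((x : L) * y) = (x : L) * ρ g y
  rw [map_mul, mem_fixedField_range.1 x.2]

theorem finrank_fixedField_range [Finite G] (hρ : Function.Injective ρ) :
    Module.finrank (fixedField ρ.range) L = Nat.card G := by
  let := MulSemiringAction.compHom L ρ
  have := isGaloisGroup_fixedField hρ
  exact (IsGaloisGroup.card_eq_finrank G _ _).symm

/-- An intermediate field over the fixed field on which `G` acts faithfully is everything. -/
theorem sup_fixedField_eq_top [Finite G] (hρ : Function.Injective ρ) {E : IntermediateField K L}
    (hE : ∀ g, (∀ x ∈ E, ρ g x = x) → g = 1) : E ⊔ fixedField ρ.range = ⊤ := by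
  let := MulSemiringAction.compHom L ρ
  have := isGaloisGroup_fixedField hρ
  set F := extendScalars (le_sup_right : fixedField ρ.range ≤ E ⊔ fixedField ρ.range) with hF
  have h1 : fixingSubgroup G (F : Set L) = ⊥ := by
    rw [eq_bot_iff]
    intro g hg
    rw [mem_fixingSubgroup_iff] at hg
    exact hE g fun x hx ↦ hg x ((le_sup_left : E ≤ E ⊔ fixedField ρ.range) hx)
  have h2 := IsGaloisGroup.fixedPoints_fixingSubgroup (G := G) (K := fixedField ρ.range) (L := L)
    (F := F)
  rw [h1, IsGaloisGroup.fixedPoints_bot] at h2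
  rw [eq_top_iff]
  intro x _
  have : x ∈ F := h2 ▸ IntermediateField.mem_top
  exact this

theorem Compresses.relfinrank_eq [Finite G] {E : IntermediateField K L} (hE : Compresses ρ E) :
    relfinrank (E ⊓ fixedField ρ.range) E = Nat.card G := by
  rw [relfinrank_eq_finrank_of_le inf_le_left]
  set F := extendScalars (inf_le_left : E ⊓ fixedField ρ.range ≤ E)
  let : MulSemiringAction G F :=
    { smul g x := ⟨ρ g x, hE.stable g _ x.2⟩
      one_smul x := Subtype.ext <| by change ρ 1 (x : L) = x; simp
      mul_smul g h x := Subtype.ext <| by change ρ (g * h) (x : L) = ρ g (ρ h x); simp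
      smul_zero g := Subtype.ext <| map_zero (ρ g)
      smul_add g x y := Subtype.ext <| map_add (ρ g) (x : L) y
      smul_one g := Subtype.ext <| map_one (ρ g)
      smul_mul g x y := Subtype.ext <| map_mul (ρ g) (x : L) y }
  have hsm : ∀ (g : G) (x : F), ((g • x : F) : L) = ρ g x := fun _ _ ↦ rfl
  have : IsGaloisGroup G (E ⊓ fixedField ρ.range : IntermediateField K L) F :=
    { faithful := ⟨fun {a b} h ↦ by
        have : b⁻¹ * a = 1 := hE.faithful _ fun x hx ↦ by
          have := congrArg Subtype.val (h ⟨x, hx⟩)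
          rw [hsm, hsm] at this
          rw [map_mul, AlgEquiv.mul_apply, this, ← AlgEquiv.mul_apply, ← map_mul]
          simp
        exact (inv_mul_eq_one.1 this).symm⟩
      commutes := ⟨fun g x y ↦ Subtype.ext <| by
        change ρ g ((x : L) * y) = (x : L) * ρ g y
        rw [map_mul, mem_fixedField_range.1 x.2.2]⟩
      isInvariant := ⟨fun b hb ↦ ⟨⟨b, b.2, mem_fixedField_range.2 fun g ↦
        congrArg Subtype.val (hb g)⟩, rfl⟩⟩ }
  exact (IsGaloisGroup.card_eq_finrank G _ _).symm

/-- By Artin's theorem both E/E^G and L/L^G have degree |G|. Only the identity of G fixes the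
compositum of E and L^G, so that compositum is L. -/
theorem Compresses.isDefinedOver [Finite G] (hρ : Function.Injective ρ)
    {E : IntermediateField K L} (hE : Compresses ρ E) :
    IsDefinedOver K (fixedField ρ.range) (E ⊓ fixedField ρ.range) :=
  ⟨inf_le_right, E, inf_le_left, by rw [hE.relfinrank_eq, finrank_fixedField_range hρ],
    sup_fixedField_eq_top hρ hE.faithful⟩

theorem Compresses.trdeg_inf_fixedField [Finite G] {E : IntermediateField K L}
    (hE : Compresses ρ E) :
    Algebra.trdeg K (E ⊓ fixedField ρ.range : IntermediateField K L) = Algebra.trdeg K E := by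
  refine (trdeg_eq_of_le_of_isAlgebraic inf_le_left fun x hx ↦ ?_).symm
  exact isAlgebraic_of_relfinrank_pos inf_le_left (hE.relfinrank_eq ▸ Nat.card_pos) hx

/-- If `L / L ^ G` is defined over `E₀`, then the algebraic closure of `E₀` in `L` is stable under
`G`, and `G` acts faithfully on it. -/
theorem IsDefinedOver.exists_compresses [Finite G] (hρ : Function.Injective ρ)
    {E₀ : IntermediateField K L} (h : IsDefinedOver K (fixedField ρ.range) E₀) :
    ∃ E : IntermediateField K L, Compresses ρ E ∧ Algebra.trdeg K E = Algebra.trdeg K E₀ := by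
  obtain ⟨h0, E, hE, hrel, hsup⟩ := h
  -- E itself need not be G-stable. The algebraic closure of E₀ is, because G fixes E₀ ≤ L^G
  -- pointwise.
  set A : IntermediateField K L := (algebraicClosure E₀ L).restrictScalars K with hA
  have memA : ∀ x, x ∈ A ↔ IsAlgebraic E₀ x := fun x ↦ by
    rw [hA, IntermediateField.mem_restrictScalars, mem_algebraicClosure_iff]
  have hE₀A : E₀ ≤ A := fun x hx ↦ (memA x).2 (isAlgebraic_algebraMap (⟨x, hx⟩ : E₀))
  have hEA : E ≤ A := fun x hx ↦ by
    rw [finrank_fixedField_range hρ] at hrel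
    exact (memA x).2 (isAlgebraic_of_relfinrank_pos hE (hrel ▸ Nat.card_pos) hx)
  refine ⟨A, ⟨fun g x hx ↦ ?_, fun g hg ↦ ?_⟩,
    trdeg_eq_of_le_of_isAlgebraic hE₀A fun x hx ↦ (memA x).1 hx⟩
  · rw [memA] at hx ⊢
    let f : L →ₐ[E₀] L := { (ρ g : L →+* L) with
      commutes' := fun r ↦ mem_fixedField_range.1 (h0 r.2) g }
    exact hx.algHom f
  · apply hρ
    rw [map_one]
    -- An element trivial on A fixes E and L^G, hence their compositum L.
    have : (⊤ : IntermediateField K L) ≤ fixedField (Subgroup.zpowers (ρ g)) := by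
      rw [← hsup, sup_le_iff]
      have key : ∀ x, ρ g x = x → x ∈ fixedField (Subgroup.zpowers (ρ g)) := fun x hx ↦ by
        rw [IntermediateField.mem_fixedField_iff]
        intro f hf
        have : Subgroup.zpowers (ρ g) ≤ MulAction.stabilizer (L ≃ₐ[K] L) x := by
          rw [Subgroup.zpowers_le]; exact hx
        exact this hf
      exact ⟨fun x hx ↦ key x (hg x (hEA hx)), fun x hx ↦ key x (mem_fixedField_range.1 hx g)⟩
    ext x
    exact (IntermediateField.mem_fixedField_iff _ _).1 (this (mem_top : x ∈ ⊤)) _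
      (Subgroup.mem_zpowers _)

theorem edExt_le_of_compresses [Finite G] (hρ : Function.Injective ρ) {E : IntermediateField K L}
    (hE : Compresses ρ E) {d : ℕ} (hd : Algebra.trdeg K E = d) :
    edExt K (fixedField ρ.range) ≤ d :=
  Nat.sInf_le ⟨_, hE.isDefinedOver hρ, hE.trdeg_inf_fixedField.trans hd⟩

/-- Finite transcendence degree makes the set of degrees nonempty (L is itself a compression), so
the infimum is attained and is not the default value 0. -/
theorem exists_compresses_trdeg_eq_edExt [Finite G] (hρ : Function.Injective ρ)
    (hL : Algebra.trdeg K L < Cardinal.aleph0) :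
    ∃ E : IntermediateField K L, Compresses ρ E ∧
      Algebra.trdeg K E = (edExt K (fixedField ρ.range) : Cardinal) := by
  have htop : Compresses ρ (⊤ : IntermediateField K L) :=
    ⟨fun _ _ _ ↦ mem_top, fun g hg ↦ hρ <| by ext x; simpa using hg x mem_top⟩
  obtain ⟨d, hd⟩ := Cardinal.lt_aleph0.1 hL
  have hne : {d : ℕ | ∃ E₀ : IntermediateField K L,
      IsDefinedOver K (fixedField ρ.range) E₀ ∧ Algebra.trdeg K E₀ = (d : Cardinal)}.Nonempty :=
    ⟨d, _, htop.isDefinedOver hρ, htop.trdeg_inf_fixedField.trans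
      ((AlgEquiv.trdeg_eq IntermediateField.topEquiv).trans hd)⟩
  obtain ⟨E₀, h, h'⟩ := Nat.sInf_mem hne
  obtain ⟨E, hE, htr⟩ := h.exists_compresses hρ
  exact ⟨E, hE, htr.trans h'⟩

end Galois
end EssDim

namespace EssDim
open IntermediateField

/-! ### Transcendence degree of residue fields -/

section Places

open Cardinal

universe u v w

theorem trdeg_adjoin_eq {K M : Type*} [Field K] [Field M] [Algebra K M] (S : Set M) :
    Algebra.trdeg K (adjoin K S) = Algebra.trdeg K (Algebra.adjoin K S) := by
  let _ : Algebra (Algebra.adjoin K S) (adjoin K S) :=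
    (Subalgebra.inclusion (algebra_adjoin_le_adjoin K S)).toRingHom.toAlgebra
  have : IsScalarTower K (Algebra.adjoin K S) (adjoin K S) :=
    IsScalarTower.of_algebraMap_eq fun _ ↦ rfl
  have hinj : Function.Injective (algebraMap (Algebra.adjoin K S) (adjoin K S)) :=
    Subalgebra.inclusion_injective _
  have : FaithfulSMul (Algebra.adjoin K S) (adjoin K S) :=
    (faithfulSMul_iff_algebraMap_injective _ _).2 hinj
  have : Algebra.IsAlgebraic (Algebra.adjoin K S) (adjoin K S) := ⟨fun x ↦ by
    obtain ⟨r, hr, s, hs, hx⟩ := (IntermediateField.mem_adjoin_iff_div).1 x.2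
    have : x = algebraMap _ (adjoin K S) (⟨r, hr⟩ : Algebra.adjoin K S) *
        (algebraMap _ (adjoin K S) (⟨s, hs⟩ : Algebra.adjoin K S))⁻¹ :=
      Subtype.ext <| hx.trans (div_eq_mul_inv r s)
    rw [this]
    exact (isAlgebraic_algebraMap _).mul (isAlgebraic_algebraMap _).inv⟩
  have h := _root_.trdeg_add_eq K (Algebra.adjoin K S) (A := adjoin K S)
  rw [trdeg_eq_zero (R := Algebra.adjoin K S), add_zero] at h
  exact h.symm

/-- A surjection with nonzero kernel onto a `K`-algebra strictly drops the transcendence degree. -/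
theorem lift_trdeg_add_one_le {K : Type u} {B : Type v} {A : Type w} [Field K] [CommRing B]
    [IsDomain B] [CommRing A] [IsDomain A] [Algebra K B] [Algebra K A] (φ : B →ₐ[K] A)
    (hφ : Function.Surjective φ) {e : B} (he : e ≠ 0) (he' : φ e = 0) :
    lift.{v} (Algebra.trdeg K A) + 1 ≤ lift.{w} (Algebra.trdeg K B) := by
  obtain ⟨s, hs⟩ := exists_isTranscendenceBasis K A
  choose f hf using hφ
  have hx : AlgebraicIndependent K (fun i : s ↦ f i) :=
    AlgebraicIndependent.of_comp φ (by simpa only [Function.comp_def, hf] using hs.1)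
  -- An algebraic relation for e can be taken with nonzero constant coefficient. Since φ e = 0,
  -- applying φ kills that coefficient, which is a polynomial in the lifts of a transcendence basis
  -- of A. The polynomial is therefore zero.
  have htr : Transcendental (Algebra.adjoin K (Set.range fun i : s ↦ f i)) e := by
    intro halg
    obtain ⟨q, hq0, hq⟩ := halg.exists_nonzero_coeff_and_aeval_eq_zero
      (mem_nonZeroDivisors_of_ne_zero he)
    apply hq0
    obtain ⟨P, hP⟩ : ∃ P, MvPolynomial.aeval (fun i : s ↦ f i) P = (q.coeff 0 : B) :=
      (Algebra.adjoin_range_eq_range_aeval K fun i : s ↦ f i).le (q.coeff 0).2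
    have h0 : φ (q.coeff 0 : B) = 0 := by
      have h1 := congrArg φ hq
      rw [Polynomial.aeval_def, Polynomial.eval₂_eq_sum_range, map_sum,
        Finset.sum_eq_single 0] at h1
      · simpa using h1
      · intro b _ hb
        simp [he', hb]
      · simp
    rw [← hP, ← AlgHom.comp_apply, MvPolynomial.comp_aeval] at h0
    have h2 : P = 0 := by
      refine hs.1 ?_
      rw [map_zero, ← h0]
      congr 2
      ext i
      exact (hf i).symm
    apply Subtype.ext
    rw [← hP, h2, map_zero]
    rfl
  have hopt := (hx.option_iff_transcendental e).2 htr
  have h3 := hopt.lift_cardinalMk_le_trdeg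
  rw [mk_option, lift_add, lift_one, hs.cardinalMk_eq_trdeg] at h3
  exact h3

variable {K : Type u} {L : Type v} {M : Type w} [Field K] [Field L] [Field M]
  [Algebra K L] [Algebra K M]

/-- The residues in `M` of the elements of `E`, for a `K`-algebra homomorphism from a subring of `L`
to `M` given by its graph `Γ`. -/
def residues (Γ : Subalgebra K (L × M)) (E : IntermediateField K L) : Set M :=
  {y | ∃ x ∈ E, (x, y) ∈ Γ}

/-- The elements of the graph `Γ` whose first component is in `E`. -/
def residueGraph (Γ : Subalgebra K (L × M)) (E : IntermediateField K L) : Subalgebra K (L × M) :=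
  Γ ⊓ E.toSubalgebra.comap (AlgHom.fst K L M)

theorem map_snd_residueGraph (Γ : Subalgebra K (L × M)) (E : IntermediateField K L) :
    (residueGraph Γ E).map (AlgHom.snd K L M) = Algebra.adjoin K (residues Γ E) := by
  have hT : (((residueGraph Γ E).map (AlgHom.snd K L M) : Subalgebra K M) : Set M) =
      residues Γ E := by
    ext y
    constructor
    · rintro ⟨⟨x, y⟩, ⟨h1, h2⟩, rfl⟩
      exact ⟨x, h2, h1⟩
    · rintro ⟨x, h2, h1⟩
      exact ⟨⟨x, y⟩, ⟨h1, h2⟩, rfl⟩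
  rw [← hT, Algebra.adjoin_eq]

/-- The first projection of `residueGraph Γ E`. -/
def residueGraphFst (Γ : Subalgebra K (L × M)) (E : IntermediateField K L) :
    residueGraph Γ E →ₐ[K] E.toSubalgebra :=
  ((AlgHom.fst K L M).comp (residueGraph Γ E).val).codRestrict E.toSubalgebra fun x ↦ x.2.2

/-- The second projection of `residueGraph Γ E`. -/
def residueGraphSnd (Γ : Subalgebra K (L × M)) (E : IntermediateField K L) :
    residueGraph Γ E →ₐ[K] Algebra.adjoin K (residues Γ E) :=
  ((AlgHom.snd K L M).comp (residueGraph Γ E).val).codRestrict _ fun x ↦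
    (map_snd_residueGraph Γ E).le ⟨x, x.2, rfl⟩

theorem residueGraphSnd_surjective (Γ : Subalgebra K (L × M)) (E : IntermediateField K L) :
    Function.Surjective (residueGraphSnd Γ E) := by
  rintro ⟨y, hy⟩
  obtain ⟨x, hx, rfl⟩ := (map_snd_residueGraph Γ E).ge hy
  exact ⟨⟨x, hx⟩, rfl⟩

theorem residueGraphFst_injective {Γ : Subalgebra K (L × M)} (hΓ : ∀ y, ((0 : L), y) ∈ Γ → y = 0)
    (E : IntermediateField K L) : Function.Injective (residueGraphFst Γ E) := by
  rw [injective_iff_map_eq_zero]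
  rintro ⟨⟨x, y⟩, h1, h2⟩ h
  have hx : x = 0 := congrArg Subtype.val h
  subst hx
  obtain rfl := hΓ y h1
  rfl

theorem lift_le_lift_of_le_of_le {a : Cardinal.{w}} {b : Cardinal.{max v w}} {c : Cardinal.{v}}
    (h : lift.{max v w, w} a ≤ lift.{w, max v w} b)
    (h' : lift.{v, max v w} b ≤ lift.{max v w, v} c) : lift.{v, w} a ≤ lift.{w, v} c := by
  rw [lift_umax.{v, w}, lift_id'.{v, w}] at h'
  rw [lift_umax.{w, v}, lift_id'.{w, v}] at h
  exact h.trans h'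

/-- The part of Γ over E embeds into E by the first projection and maps onto the ring generated by
the residues by the second. -/
theorem lift_trdeg_residues_le {Γ : Subalgebra K (L × M)} (hΓ : ∀ y, ((0 : L), y) ∈ Γ → y = 0)
    (E : IntermediateField K L) :
    lift.{v} (Algebra.trdeg K (adjoin K (residues Γ E))) ≤ lift.{w} (Algebra.trdeg K E) := by
  have h1 := lift_trdeg_le_of_injective _ (residueGraphFst_injective hΓ E)
  have h2 := lift_trdeg_le_of_surjective _ (residueGraphSnd_surjective Γ E)
  rw [trdeg_adjoin_eq]
  exact lift_le_lift_of_le_of_le h2 h1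

theorem lift_trdeg_residues_add_one_le {Γ : Subalgebra K (L × M)}
    (hΓ : ∀ y, ((0 : L), y) ∈ Γ → y = 0) (E : IntermediateField K L) {x : L} (hxE : x ∈ E)
    (hx : x ≠ 0) (hxΓ : (x, (0 : M)) ∈ Γ) :
    lift.{v} (Algebra.trdeg K (adjoin K (residues Γ E))) + 1 ≤
      lift.{w} (Algebra.trdeg K E) := by
  have h1 := lift_trdeg_le_of_injective _ (residueGraphFst_injective hΓ E)
  have := (residueGraphFst_injective hΓ E).isDomain
  have h2 := lift_trdeg_add_one_le _ (residueGraphSnd_surjective Γ E)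
    (e := ⟨(x, 0), hxΓ, hxE⟩) (fun h ↦ hx (congrArg (fun z : residueGraph Γ E ↦ (z : L × M).1) h)) rfl
  rw [trdeg_adjoin_eq]
  have h3 := lift_le_lift_of_le_of_le
    (a := Algebra.trdeg K (Algebra.adjoin K (residues Γ E)) + 1) (by rwa [lift_add, lift_one]) h1
  rwa [lift_add, lift_one] at h3

end Places
end EssDim

namespace EssDim
open IntermediateField

theorem Compresses.adjoin_residues {K L M G : Type*} [Field K] [Field L] [Field M] [Algebra K L]
    [Algebra K M] [Group G] {ρ : G →* (L ≃ₐ[K] L)} {σ : G →* (M ≃ₐ[K] M)}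
    {Γ : Subalgebra K (L × M)} (hΓ : ∀ g x y, (x, y) ∈ Γ → (ρ g x, σ g y) ∈ Γ)
    {E : IntermediateField K L} (hE : ∀ g, ∀ x ∈ E, ρ g x ∈ E)
    (hf : ∀ g, (∀ y ∈ residues Γ E, σ g y = y) → g = 1) :
    Compresses σ (adjoin K (residues Γ E)) where
  stable g x hx := by
    have : adjoin K (residues Γ E) ≤ (adjoin K (residues Γ E)).comap (σ g : M →ₐ[K] M) := by
      rw [adjoin_le_iff]
      rintro y ⟨x, hx, hxy⟩
      exact subset_adjoin K _ ⟨ρ g x, hE g x hx, hΓ g x y hxy⟩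
    exact this hx
  faithful g hg := hf g fun y hy ↦ hg y (subset_adjoin K _ hy)

/-! ### Permutation actions on rational function fields -/

section Permutation

variable (K : Type*) [Field K] {G H X : Type*} [Group G] [Group H]

/-- The action on the polynomial ring `K[x_i : i ∈ X]` of a group acting on `X`. -/
noncomputable def permPolyAction (a : G →* Equiv.Perm X) :
    G →* (MvPolynomial X K ≃ₐ[K] MvPolynomial X K) where
  toFun g := MvPolynomial.renameEquiv K (a g)
  map_one' := by
    apply AlgEquiv.coe_toAlgHom_injective
    apply MvPolynomial.algHom_ext
    intro x
    simp
  map_mul' g h := by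
    apply AlgEquiv.coe_toAlgHom_injective
    apply MvPolynomial.algHom_ext
    intro x
    simp

/-- The action on the function field `K(x_i : i ∈ X)` of a group acting on `X`. -/
noncomputable def permAction (a : G →* Equiv.Perm X) :
    G →* (RegField K X ≃ₐ[K] RegField K X) :=
  (IsFractionRing.fieldEquivOfAlgEquivHom K (RegField K X)).comp (permPolyAction K a)

theorem regAction_eq_permAction : regAction K G = permAction K (MulAction.toPermHom G G) := rfl

variable {K}

theorem permPolyAction_apply (a : G →* Equiv.Perm X) (g : G) (p : MvPolynomial X K) :
    permPolyAction K a g p = MvPolynomial.rename (a g) p := rfl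

@[simp]
theorem permAction_algebraMap (a : G →* Equiv.Perm X) (g : G) (p : MvPolynomial X K) :
    permAction K a g (algebraMap _ (RegField K X) p) =
      algebraMap _ (RegField K X) (MvPolynomial.rename (a g) p) :=
  IsFractionRing.fieldEquivOfAlgEquiv_algebraMap K (RegField K X) (RegField K X)
    (permPolyAction K a g) p

theorem permAction_injective {a : G →* Equiv.Perm X} (ha : Function.Injective a) :
    Function.Injective (permAction K a) := by
  refine (IsFractionRing.fieldEquivOfAlgEquivHom_injective _ _ K (RegField K X)).comp ?_
  intro g h hgh
  apply ha
  ext x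
  have := AlgEquiv.ext_iff.1 hgh (MvPolynomial.X x)
  simpa [permPolyAction_apply, MvPolynomial.X_inj] using this

theorem regAction_injective : Function.Injective (regAction K G) := by
  rw [regAction_eq_permAction]
  exact permAction_injective fun g h hgh ↦ by simpa using Equiv.ext_iff.1 hgh 1

theorem trdeg_regField_lt_aleph0 [Finite X] : Algebra.trdeg K (RegField K X) < Cardinal.aleph0 := by
  have h := _root_.trdeg_add_eq K (MvPolynomial X K) (A := RegField K X)
  have : Algebra.IsAlgebraic (MvPolynomial X K) (RegField K X) :=
    IsLocalization.isAlgebraic _ (nonZeroDivisors (MvPolynomial X K))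
  rw [trdeg_eq_zero (R := MvPolynomial X K), add_zero] at h
  rw [← h]
  exact trdeg_lt_aleph0_of_finiteType

theorem ed_le_of_compresses [Finite G] {E : IntermediateField K (RegField K G)}
    (hE : Compresses (regAction K G) E) {d : ℕ} (hd : Algebra.trdeg K E ≤ d) : ed K G ≤ d := by
  obtain ⟨n, hn⟩ := Cardinal.lt_aleph0.1 (hd.trans_lt (Cardinal.natCast_lt_aleph0 (n := d)))
  rw [hn] at hd
  exact (edExt_le_of_compresses regAction_injective hE hn).trans (by exact_mod_cast hd)

variable (K G) in
theorem exists_compresses_trdeg_eq_ed [Finite G] :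
    ∃ E : IntermediateField K (RegField K G), Compresses (regAction K G) E ∧
      Algebra.trdeg K E = (ed K G : Cardinal) :=
  exists_compresses_trdeg_eq_edExt regAction_injective trdeg_regField_lt_aleph0

/-- A set with a free action of `G` embeds into a product of `G` and a trivial `G`-set. -/
theorem exists_equivariant_of_free [Finite X] (a : G →* Equiv.Perm X)
    (ha : ∀ g x, a g x = x → g = 1) : ∃ (f : X → G) (i : X → ℕ),
      (∀ g x, f (a g x) = g * f x) ∧ (∀ g x, i (a g x) = i x) ∧
      ∀ x y, f x = f y → i x = i y → x = y := by
  obtain ⟨e, he⟩ := Countable.exists_injective_nat X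
  let S : Setoid X :=
    { r x y := ∃ g, a g x = y
      iseqv :=
        { refl x := ⟨1, by simp⟩
          symm := by
            rintro x y ⟨g, rfl⟩
            exact ⟨g⁻¹, by simp⟩
          trans := by
            rintro x y z ⟨g, rfl⟩ ⟨h, rfl⟩
            exact ⟨h * g, by simp⟩ } }
  let rep : X → X := fun x ↦ (Quotient.mk S x).out
  have hrep : ∀ x, ∃ g, a g (rep x) = x := fun x ↦ Quotient.mk_out (s := S) x
  choose f hf using hrep
  have hrep' : ∀ g x, rep (a g x) = rep x := fun g x ↦ by
    have : Quotient.mk S (a g x) = Quotient.mk S x := (Quotient.sound (s := S) ⟨g, rfl⟩).symm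
    simp only [rep, this]
  refine ⟨f, fun x ↦ e (rep x), fun g x ↦ ?_, fun g x ↦ congrArg e (hrep' g x), fun x y h1 h2 ↦ ?_⟩
  · have h1 := hf (a g x)
    rw [hrep'] at h1
    conv_rhs at h1 => rw [← hf x]
    have h2 : a ((g * f x)⁻¹ * f (a g x)) (rep x) = rep x := by
      rw [map_mul, Equiv.Perm.mul_apply, h1, map_inv, map_mul]
      simp
    exact (inv_mul_eq_one.1 (ha _ _ h2)).symm
  · rw [← hf x, ← hf y, he h2, h1]

end Permutation

/-! ### Kronecker substitution -/

section Kronecker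

open MvPolynomial

variable {K : Type*} [Field K] {G X : Type*}

/-- The substitution `x ↦ (x_{f x}) ^ (N ^ (i x))`. -/
noncomputable def kronecker (K : Type*) [Field K] (f : X → G) (i : X → ℕ) (N : ℕ) :
    MvPolynomial X K →ₐ[K] MvPolynomial G K :=
  aeval fun x ↦ (MvPolynomial.X (f x)) ^ (N ^ i x)

/-- For suitable N the substitution sends the distinct monomials of P to distinct monomials with the
same coefficients, so nothing cancels. Unlike evaluation at constants, this also works over finite
fields. -/
theorem kronecker_ne_zero_of_ne_zero [Finite X] [Nonempty G] {f : X → G} {i : X → ℕ}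
    (hfi : ∀ x y, f x = f y → i x = i y → x = y) {P : MvPolynomial X K} (hP : P ≠ 0) :
    ∃ N, kronecker K f i N P ≠ 0 := by
  classical
  have := Fintype.ofFinite X
  -- Evaluated at N, this is the difference of the exponents of x_g in the images of the monomials m
  -- and m'.
  let D : (X →₀ ℕ) → (X →₀ ℕ) → G → Polynomial ℤ := fun m m' g ↦
    ∑ x with f x = g, Polynomial.monomial (i x) ((m x : ℤ) - m' x)
  have hD : ∀ m m', m ≠ m' → ∃ g, D m m' g ≠ 0 := fun m m' hm ↦ by
    obtain ⟨x₀, hx₀⟩ := DFunLike.ne_iff.1 hm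
    refine ⟨f x₀, fun h ↦ hx₀ ?_⟩
    have := congrArg (fun p ↦ Polynomial.coeff p (i x₀)) h
    simp only [D, Polynomial.finsetSum_coeff, Polynomial.coeff_monomial,
      Polynomial.coeff_zero] at this
    rw [Finset.sum_eq_single x₀] at this
    · simp only [if_true] at this
      omega
    · intro x hx hne
      rw [if_neg]
      exact fun h ↦ hne (hfi _ _ (by simpa using hx) h)
    · simp
  choose! g hg using hD
  have hprod : (∏ p ∈ P.support.offDiag, D p.1 p.2 (g p.1 p.2)) ≠ 0 :=
    Finset.prod_ne_zero_iff.2 fun p hp ↦ hg _ _ (Finset.mem_offDiag.1 hp).2.2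
  -- A nonzero polynomial cannot vanish at all natural numbers.
  obtain ⟨N, hN⟩ : ∃ N : ℕ,
      (∏ p ∈ P.support.offDiag, D p.1 p.2 (g p.1 p.2)).eval (N : ℤ) ≠ 0 := by
    by_contra! h
    refine hprod (Polynomial.eq_zero_of_infinite_isRoot _ ?_)
    exact (Set.infinite_range_of_injective (Nat.cast_injective (R := ℤ))).mono
      (by rintro _ ⟨N, rfl⟩; exact h N)
  rw [Polynomial.eval_prod, Finset.prod_ne_zero_iff] at hN
  let μ : (X →₀ ℕ) → (G →₀ ℕ) := fun m ↦ ∑ x, Finsupp.single (f x) (m x * N ^ i x)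
  have hμ : ∀ m ∈ P.support, ∀ m' ∈ P.support, μ m = μ m' → m = m' := by
    intro m hm m' hm' h
    by_contra hne
    refine hN (m, m') (Finset.mem_offDiag.2 ⟨hm, hm', hne⟩) ?_
    have h1 := DFunLike.congr_fun h (g m m')
    simp only [μ, Finsupp.finsetSum_apply, Finsupp.single_apply] at h1
    rw [← Finset.sum_filter, ← Finset.sum_filter] at h1
    simp only [D, Polynomial.eval_finsetSum, Polynomial.eval_monomial, sub_mul,
      Finset.sum_sub_distrib]
    rw [sub_eq_zero]
    exact_mod_cast h1
  obtain ⟨m₀, hm₀⟩ := MvPolynomial.support_nonempty.2 hP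
  refine ⟨N, fun h ↦ MvPolynomial.mem_support_iff.1 hm₀ ?_⟩
  have hmon : ∀ m c, kronecker K f i N (monomial m c) = monomial (μ m) c := fun m c ↦ by
    rw [kronecker, aeval_monomial, Finsupp.prod_fintype _ _ (by simp), algebraMap_eq]
    simp only [μ, X_pow_eq_monomial, monomial_pow, one_pow, Finsupp.smul_single, smul_eq_mul]
    rw [← MvPolynomial.monomial_sum_one, C_mul_monomial, mul_one]
  rw [P.as_sum, map_sum] at h
  have h1 := congrArg (coeff (μ m₀)) h
  simp only [hmon, coeff_sum, coeff_monomial, coeff_zero] at h1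
  rw [Finset.sum_eq_single m₀] at h1
  · simpa using h1
  · intro m hm hne
    rw [if_neg]
    exact fun h ↦ hne (hμ _ hm _ hm₀ h)
  · intro hh
    exact absurd hm₀ hh

end Kronecker
end EssDim

namespace EssDim
open IntermediateField

/-! ### Specialization of rational functions -/

section Specialization

variable {K A L M : Type*} [Field K] [CommRing A] [Field L] [Field M] [Algebra K A] [Algebra A L]
  [Algebra K L] [IsScalarTower K A L] [Algebra K M]

/-- The graph of the extension of a homomorphism `s : A → M` to the fractions of elements of `A`
with a denominator outside the kernel of `s`. -/
def specializationGraph (L : Type*) [Field L] [Algebra A L] [Algebra K L] [IsScalarTower K A L]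
    (s : A →ₐ[K] M) : Subalgebra K (L × M) where
  carrier := {z | ∃ a b : A, s b ≠ 0 ∧ z.1 * algebraMap A L b = algebraMap A L a ∧
    z.2 * s b = s a}
  mul_mem' := by
    rintro ⟨x, y⟩ ⟨x', y'⟩ ⟨a, b, hb, h1, h2⟩ ⟨a', b', hb', h1', h2'⟩
    refine ⟨a * a', b * b', by simpa using ⟨hb, hb'⟩, ?_, ?_⟩
    · rw [map_mul, map_mul, ← h1, ← h1']
      simp only [Prod.mk_mul_mk]
      ring
    · rw [map_mul, map_mul, ← h2, ← h2']
      simp only [Prod.mk_mul_mk]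
      ring
  add_mem' := by
    rintro ⟨x, y⟩ ⟨x', y'⟩ ⟨a, b, hb, h1, h2⟩ ⟨a', b', hb', h1', h2'⟩
    refine ⟨a * b' + a' * b, b * b', by simpa using ⟨hb, hb'⟩, ?_, ?_⟩
    · simp only [map_mul, map_add, ← h1, ← h1', Prod.mk_add_mk]
      ring
    · simp only [map_mul, map_add, ← h2, ← h2', Prod.mk_add_mk]
      ring
  algebraMap_mem' r := ⟨algebraMap K A r, 1, by simp, by
    simp [← IsScalarTower.algebraMap_apply], by simp⟩

theorem eq_zero_of_mem_specializationGraph (hAL : Function.Injective (algebraMap A L))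
    {s : A →ₐ[K] M} {y : M} (h : ((0 : L), y) ∈ specializationGraph L s) : y = 0 := by
  obtain ⟨a, b, hb, h1, h2⟩ := h
  have : a = 0 := hAL (by simpa using h1.symm)
  subst this
  simpa [hb] using h2

end Specialization

/-! ### Comparison with free permutation actions, and subgroups -/

section Versality

variable {K : Type*} [Field K] {G X : Type*} [Group G]

theorem kronecker_rename {f : X → G} {i : X → ℕ} (N : ℕ) {a : G →* Equiv.Perm X}
    (hf : ∀ g x, f (a g x) = g * f x) (hi : ∀ g x, i (a g x) = i x) (g : G)
    (p : MvPolynomial X K) : kronecker K f i N (MvPolynomial.rename (a g) p) =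
      MvPolynomial.rename (g * ·) (kronecker K f i N p) := by
  rw [← AlgHom.comp_apply, ← AlgHom.comp_apply]
  congr 1
  ext x
  simp [kronecker, hf, hi]

/-- Every field of rational functions in variables permuted freely by `G` on which `G` acts
faithfully bounds the essential dimension of `G`. -/
theorem ed_le_of_compresses_permAction [Finite G] [Finite X] {a : G →* Equiv.Perm X}
    (ha : ∀ g x, a g x = x → g = 1) {E : IntermediateField K (RegField K X)}
    (hE : Compresses (permAction K a) E) {d : ℕ} (hd : Algebra.trdeg K E ≤ d) : ed K G ≤ d := by
  classical
  have := Fintype.ofFinite G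
  obtain ⟨f, i, hf, hi, hfi⟩ := exists_equivariant_of_free a ha
  -- For each g ≠ 1 a fraction p/q in E is moved by g. The polynomial q (g(p) q − p g(q)) records
  -- both that q ≠ 0 and that the fraction moves.
  have hne : ∀ g : G, g ≠ 1 → ∃ p q : MvPolynomial X K,
      algebraMap _ (RegField K X) p / algebraMap _ (RegField K X) q ∈ E ∧
      q * (MvPolynomial.rename (a g) p * q - p * MvPolynomial.rename (a g) q) ≠ 0 := by
    intro g hg
    have : ¬ ∀ x ∈ E, permAction K a g x = x := fun h ↦ hg (hE.faithful g h)
    push Not at this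
    obtain ⟨x, hx, hgx⟩ := this
    obtain ⟨p, q, hq, rfl⟩ := IsFractionRing.div_surjective (A := MvPolynomial X K) x
    have hq0 : q ≠ 0 := nonZeroDivisors.ne_zero hq
    have hinj := IsFractionRing.injective (MvPolynomial X K) (RegField K X)
    have hgq : MvPolynomial.rename (a g) q ≠ 0 :=
      (map_ne_zero_iff _ (MvPolynomial.rename_injective _ (a g).injective)).2 hq0
    refine ⟨p, q, hx, mul_ne_zero hq0 fun h ↦ hgx ?_⟩
    rw [map_div₀, permAction_algebraMap, permAction_algebraMap,
      div_eq_div_iff ((map_ne_zero_iff _ hinj).2 hgq) ((map_ne_zero_iff _ hinj).2 hq0),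
      ← map_mul, ← map_mul, sub_eq_zero.1 h]
  choose! p q hpq hne using hne
  -- A single N serves all g: take it for the product of these polynomials. The substitution then
  -- keeps every denominator nonzero and every witness moved.
  obtain ⟨N, hN⟩ := kronecker_ne_zero_of_ne_zero hfi (Finset.prod_ne_zero_iff.2
    fun g (hg : g ∈ Finset.univ.erase (1 : G)) ↦ hne g (Finset.ne_of_mem_erase hg))
  let s : MvPolynomial X K →ₐ[K] RegField K G :=
    (IsScalarTower.toAlgHom K (MvPolynomial G K) (RegField K G)).comp (kronecker K f i N)
  have hs : ∀ g P, s (MvPolynomial.rename (a g) P) = regAction K G g (s P) := fun g P ↦ by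
    rw [regAction_eq_permAction]
    refine Eq.trans ?_ (permAction_algebraMap _ _ _).symm
    exact congrArg (algebraMap (MvPolynomial G K) (RegField K G)) (kronecker_rename N hf hi g P)
  have hsN : ∀ g, g ≠ 1 →
      s (q g * (MvPolynomial.rename (a g) (p g) * q g -
        p g * MvPolynomial.rename (a g) (q g))) ≠ 0 := fun g hg h ↦ by
    refine hN ?_
    rw [map_prod]
    exact Finset.prod_eq_zero (Finset.mem_erase.2 ⟨hg, Finset.mem_univ g⟩)
      (IsFractionRing.injective (MvPolynomial G K) (RegField K G) (by rw [map_zero]; exact h))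
  have hinj := IsFractionRing.injective (MvPolynomial X K) (RegField K X)
  have hΓ : ∀ y, ((0 : RegField K X), y) ∈ specializationGraph (RegField K X) s → y = 0 :=
    fun y hy ↦ eq_zero_of_mem_specializationGraph hinj hy
  refine ed_le_of_compresses (E := adjoin K (residues (specializationGraph (RegField K X) s) E))
    (Compresses.adjoin_residues (ρ := permAction K a) ?_ hE.stable ?_) ?_
  · rintro g x y ⟨u, v, hv, h1, h2⟩
    refine ⟨MvPolynomial.rename (a g) u, MvPolynomial.rename (a g) v, ?_, ?_, ?_⟩
    · rwa [hs, map_ne_zero]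
    · rw [← permAction_algebraMap, ← permAction_algebraMap, ← h1, map_mul]
    · rw [hs, hs, ← h2, map_mul]
  · intro g hg
    by_contra hne1
    have h := hsN g hne1
    rw [map_mul, mul_ne_zero_iff] at h
    refine h.2 ?_
    have hq0 : algebraMap _ (RegField K X) (q g) ≠ 0 := (map_ne_zero_iff _ hinj).2 fun h0 ↦ h.1 <| by
      rw [h0, map_zero]
    have h3 := hg (s (p g) / s (q g)) ⟨_, hpq g hne1, p g, q g, h.1, div_mul_cancel₀ _ hq0,
      div_mul_cancel₀ _ h.1⟩
    rw [map_div₀, ← hs, ← hs, div_eq_div_iff (by rw [hs, map_ne_zero]; exact h.1) h.1] at h3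
    rw [map_sub, map_mul, map_mul, h3, sub_self]
  · have h := lift_trdeg_residues_le hΓ E
    have h' := h.trans (Cardinal.lift_le.2 hd)
    rw [Cardinal.lift_natCast] at h'
    simpa using h'

/-- The essential dimension of a subgroup is at most that of the group. -/
theorem ed_le_of_injective {H : Type*} [Group H] [Finite G] [Finite H] (φ : H →* G)
    (hφ : Function.Injective φ) : ed K H ≤ ed K G := by
  obtain ⟨E, hE, htr⟩ := exists_compresses_trdeg_eq_ed K G
  refine ed_le_of_compresses_permAction (a := (MulAction.toPermHom G G).comp φ) (E := E)
    (fun h x hx ↦ hφ ?_) ⟨fun h x hx ↦ hE.stable (φ h) x hx, fun h hh ↦ hφ ?_⟩ htr.le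
  · rw [map_one]
    exact mul_eq_right.1 hx
  · rw [map_one]
    exact hE.faithful (φ h) hh

end Versality
end EssDim

namespace EssDim
open IntermediateField

/-! ### Orders and leading coefficients in Laurent series -/

section Laurent

variable {K L F : Type*} [Field K] [Field L] [Field F] [Algebra K L]

/-- The leading coefficient of the Laurent series attached to an element of `L`. -/
noncomputable def leadHom (Φ : L →+* LaurentSeries F) : L →*₀ F where
  toFun f := (Φ f).leadingCoeff
  map_zero' := by simp
  map_one' := by simp
  map_mul' f g := by rw [map_mul, HahnSeries.leadingCoeff_mul]

/-- The order of the Laurent series attached to an element of `Lˣ`. -/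
noncomputable def orderHom (Φ : L →+* LaurentSeries F) : Lˣ →* Multiplicative ℤ where
  toFun f := Multiplicative.ofAdd (Φ f).order
  map_one' := by simp
  map_mul' f g := by
    rw [Units.val_mul, map_mul, HahnSeries.order_mul (by simp) (by simp), ofAdd_add]

theorem leadHom_apply (Φ : L →+* LaurentSeries F) (f : L) : leadHom Φ f = (Φ f).leadingCoeff := rfl

theorem order_map_zpow (Φ : L →+* LaurentSeries F) {f : L} (hf : f ≠ 0) (k : ℤ) :
    (Φ (f ^ k)).order = k * (Φ f).order := by
  have h := map_zpow (orderHom Φ) (Units.mk0 f hf) k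
  have h' := congrArg Multiplicative.toAdd h
  simpa [orderHom] using h'

theorem order_map_mul (Φ : L →+* LaurentSeries F) {f g : L} (hf : f ≠ 0) (hg : g ≠ 0) :
    (Φ (f * g)).order = (Φ f).order + (Φ g).order := by
  rw [map_mul, HahnSeries.order_mul (by simpa) (by simpa)]

theorem order_map_div (Φ : L →+* LaurentSeries F) {f g : L} (hf : f ≠ 0) (hg : g ≠ 0) :
    (Φ (f / g)).order = (Φ f).order - (Φ g).order := by
  have h := order_map_mul Φ (div_ne_zero hf hg) hg
  rw [div_mul_cancel₀ _ hg] at h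
  omega

theorem exists_powerSeries_of_order_nonneg {x : LaurentSeries F} (hx : 0 ≤ x.order) :
    ∃ P : PowerSeries F, HahnSeries.ofPowerSeries ℤ F P = x ∧
      PowerSeries.constantCoeff P = x.coeff 0 := by
  obtain ⟨n, hn⟩ := Int.eq_ofNat_of_zero_le hx
  refine ⟨PowerSeries.X ^ n * x.powerSeriesPart,
    LaurentSeries.X_order_mul_powerSeriesPart hn.symm, ?_⟩
  conv_rhs => rw [← LaurentSeries.X_order_mul_powerSeriesPart hn.symm]
  have := LaurentSeries.coeff_coe_powerSeries (PowerSeries.X ^ n * x.powerSeriesPart) 0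
  rw [PowerSeries.coeff_zero_eq_constantCoeff_apply] at this
  exact this.symm

theorem order_ofPowerSeries_nonneg (P : PowerSeries F) :
    0 ≤ (HahnSeries.ofPowerSeries ℤ F P).order := by
  by_contra! h
  have h0 : HahnSeries.ofPowerSeries ℤ F P ≠ 0 := by
    rintro h0
    simp [h0] at h
  have h1 := HahnSeries.leadingCoeff_ne_zero.2 h0
  rw [HahnSeries.leadingCoeff_eq] at h1
  exact h1 ((PowerSeries.coeff_coe P _).trans (if_pos h))

section Graph

variable [Algebra K F]

/-- The graph of the residue map of the place of `L` defined by an embedding into a field of Laurent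
series. -/
noncomputable def residueMapGraph (Φ : L →+* LaurentSeries F)
    (hΦ : ∀ r, Φ (algebraMap K L r) = HahnSeries.C (algebraMap K F r)) :
    Subalgebra K (L × F) where
  carrier := {z | ∃ P : PowerSeries F, HahnSeries.ofPowerSeries ℤ F P = Φ z.1 ∧
    PowerSeries.constantCoeff P = z.2}
  mul_mem' := by
    rintro ⟨x, y⟩ ⟨x', y'⟩ ⟨P, h1, h2⟩ ⟨P', h1', h2'⟩
    exact ⟨P * P', by simp [h1, h1'], by simp [h2, h2']⟩
  add_mem' := by
    rintro ⟨x, y⟩ ⟨x', y'⟩ ⟨P, h1, h2⟩ ⟨P', h1', h2'⟩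
    exact ⟨P + P', by simp [h1, h1'], by simp [h2, h2']⟩
  algebraMap_mem' r := ⟨PowerSeries.C (algebraMap K F r), by
    rw [HahnSeries.ofPowerSeries_C]
    exact (hΦ r).symm, by simp⟩

variable {Φ : L →+* LaurentSeries F} {hΦ : ∀ r, Φ (algebraMap K L r) = HahnSeries.C (algebraMap K F r)}

theorem mem_residueMapGraph {x : L} {y : F} :
    (x, y) ∈ residueMapGraph Φ hΦ ↔ 0 ≤ (Φ x).order ∧ (Φ x).coeff 0 = y := by
  constructor
  · rintro ⟨P, h1, h2⟩
    have h1' : HahnSeries.ofPowerSeries ℤ F P = Φ x := h1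
    refine ⟨h1' ▸ order_ofPowerSeries_nonneg P, ?_⟩
    rw [← h1']
    have := LaurentSeries.coeff_coe_powerSeries P 0
    rw [PowerSeries.coeff_zero_eq_constantCoeff_apply] at this
    exact this.trans h2
  · rintro ⟨h1, h2⟩
    obtain ⟨P, hP, hP'⟩ := exists_powerSeries_of_order_nonneg h1
    exact ⟨P, hP, hP'.trans h2⟩

theorem eq_zero_of_mem_residueMapGraph {y : F} (h : ((0 : L), y) ∈ residueMapGraph Φ hΦ) :
    y = 0 := by
  rw [mem_residueMapGraph] at h
  simpa using h.2.symm

end Graph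

theorem coeff_zero_of_order_nonneg {x : LaurentSeries F} (hx : 0 ≤ x.order) :
    x.coeff 0 = if x.order = 0 then x.leadingCoeff else 0 := by
  split_ifs with h
  · rw [HahnSeries.leadingCoeff_eq, h]
  · exact HahnSeries.coeff_eq_zero_of_lt_order (lt_of_le_of_ne hx (Ne.symm h))

/-- An element of finite order `ℓ ≠ 0` in `K` that fixes all leading coefficients acts trivially. -/
theorem eq_self_of_leadingCoeff_eq {E : IntermediateField K L} {Φ : L →+* LaurentSeries F}
    {τ : L ≃ₐ[K] L}
    (hE : ∀ x ∈ E, τ x ∈ E) {ℓ : ℕ} (hτ : τ ^ ℓ = 1) (hℓ : (ℓ : F) ≠ 0)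
    (hord : ∀ f ∈ E, (Φ (τ f)).order = (Φ f).order)
    (hlc : ∀ f ∈ E, leadHom Φ (τ f) = leadHom Φ f) (f : L) (hf : f ∈ E) : τ f = f := by
  by_contra hne
  -- The sum of τ^i h over i < ℓ telescopes to τ^ℓ f − f = 0, while all its terms have the order and
  -- the leading coefficient of h.
  set h := τ f - f with hh
  have hhE : h ∈ E := sub_mem (hE f hf) hf
  have hh0 : h ≠ 0 := sub_ne_zero.2 hne
  have hpow : ∀ i : ℕ, (τ ^ i) h ∈ E ∧ (Φ ((τ ^ i) h)).order = (Φ h).order ∧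
      leadHom Φ ((τ ^ i) h) = leadHom Φ h := by
    intro i
    induction i with
    | zero => simpa using hhE
    | succ i ih =>
      rw [pow_succ', AlgEquiv.mul_apply]
      exact ⟨hE _ ih.1, (hord _ ih.1).trans ih.2.1, (hlc _ ih.1).trans ih.2.2⟩
  have hsum : ∑ i ∈ Finset.range ℓ, (τ ^ i) h = 0 := by
    have : ∀ i, (τ ^ i) h = (τ ^ (i + 1)) f - (τ ^ i) f := fun i ↦ by
      rw [hh, map_sub, pow_succ, AlgEquiv.mul_apply]
    simp only [this]
    rw [Finset.sum_range_sub fun i ↦ (τ ^ i) f, hτ]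
    simp
  -- The coefficient of the vanishing sum in degree `(Φ h).order` is ℓ times the leading coefficient
  -- of h.
  have hcoeff := congrArg (fun x ↦ (Φ x).coeff (Φ h).order) hsum
  simp only [map_sum, HahnSeries.coeff_sum, map_zero, HahnSeries.coeff_zero] at hcoeff
  rw [Finset.sum_congr rfl (g := fun _ ↦ leadHom Φ h), Finset.sum_const, Finset.card_range,
    nsmul_eq_mul, mul_eq_zero] at hcoeff
  · exact hcoeff.elim hℓ ((map_ne_zero (leadHom Φ)).2 hh0)
  · intro i _
    rw [← (hpow i).2.1, ← HahnSeries.leadingCoeff_eq]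
    exact (hpow i).2.2

/-- The orders of the elements of a subfield are the multiples of the order of one of them. -/
theorem exists_order_generator (Φ : L →+* LaurentSeries F) (E : IntermediateField K L) :
    ∃ π ∈ E, π ≠ 0 ∧ ∀ f ∈ E, f ≠ 0 → ∃ k : ℤ, (Φ f).order = k * (Φ π).order := by
  let S : AddSubgroup ℤ :=
    { carrier := {m | ∃ f ∈ E, f ≠ 0 ∧ (Φ f).order = m}
      zero_mem' := ⟨1, one_mem _, one_ne_zero, by simp⟩
      add_mem' := by
        rintro _ _ ⟨f, hf, hf0, rfl⟩ ⟨g, hg, hg0, rfl⟩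
        exact ⟨f * g, mul_mem hf hg, mul_ne_zero hf0 hg0, order_map_mul Φ hf0 hg0⟩
      neg_mem' := by
        rintro _ ⟨f, hf, hf0, rfl⟩
        refine ⟨f ^ (-1 : ℤ), zpow_mem hf _, zpow_ne_zero _ hf0, ?_⟩
        rw [order_map_zpow Φ hf0]
        ring }
  obtain ⟨a, ha⟩ := Int.subgroup_cyclic S
  have haS : a ∈ S := ha ▸ AddSubgroup.subset_closure (Set.mem_singleton a)
  obtain ⟨π, hπ, hπ0, rfl⟩ := haS
  refine ⟨π, hπ, hπ0, fun f hf hf0 ↦ ?_⟩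
  have : (Φ f).order ∈ S := ⟨f, hf, hf0, rfl⟩
  rw [ha, AddSubgroup.mem_closure_singleton] at this
  obtain ⟨k, hk⟩ := this
  exact ⟨k, by rw [← hk, smul_eq_mul]⟩

end Laurent
end EssDim

namespace EssDim
open IntermediateField

/-! ### Faithfulness on the residue field -/

section Laurent

variable {K L F G C : Type*} [Field K] [Field L] [Field F] [Algebra K L] [Algebra K F]
  [Group G] [Group C]

/-- The graph of the residue map is stable under a group acting compatibly. -/
theorem residueMapGraph_stable {Φ : L →+* LaurentSeries F}
    {hΦ : ∀ r, Φ (algebraMap K L r) = HahnSeries.C (algebraMap K F r)}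
    {τ : L ≃ₐ[K] L} {σ : F ≃ₐ[K] F} (hord : ∀ f, (Φ (τ f)).order = (Φ f).order)
    (hlc : ∀ f, (Φ f).order = 0 → leadHom Φ (τ f) = σ (leadHom Φ f)) {x : L} {y : F}
    (h : (x, y) ∈ residueMapGraph Φ hΦ) : (τ x, σ y) ∈ residueMapGraph Φ hΦ := by
  rw [mem_residueMapGraph] at h ⊢
  have h' : 0 ≤ (Φ (τ x)).order := (hord x).symm ▸ h.1
  refine ⟨h', ?_⟩
  rw [← h.2, coeff_zero_of_order_nonneg h', coeff_zero_of_order_nonneg h.1, hord]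
  split_ifs with h0
  · exact hlc x h0
  · rw [map_zero]

theorem leadHom_mem_residues {Φ : L →+* LaurentSeries F}
    {hΦ : ∀ r, Φ (algebraMap K L r) = HahnSeries.C (algebraMap K F r)}
    {E : IntermediateField K L} {f : L} (hf : f ∈ E) (h : (Φ f).order = 0) :
    leadHom Φ f ∈ residues (residueMapGraph Φ hΦ) E :=
  ⟨f, hf, mem_residueMapGraph.2 ⟨h.ge, by
    rw [coeff_zero_of_order_nonneg h.ge, if_pos h]; rfl⟩⟩

/-- Let `G × C` act faithfully on a subfield `E` of `L`, where `L` is embedded into the Laurent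
series over `F` in such a way that `C` acts on the variable through the character `χ`, and `G` on
the coefficients. Under the assumptions on `G`, the group acts faithfully on the residue field of
`E`, and the transcendence degree of the latter is smaller. -/
theorem compresses_residueField [Finite G] [Finite C] [Nontrivial C]
    {Φ : L →+* LaurentSeries F}
    {hΦ : ∀ r, Φ (algebraMap K L r) = HahnSeries.C (algebraMap K F r)}
    {ρ : G × C →* (L ≃ₐ[K] L)} {σ : G →* (F ≃ₐ[K] F)} {χ : C →* F}
    (hord : ∀ γ f, (Φ (ρ γ f)).order = (Φ f).order)
    (hlc : ∀ γ f, leadHom Φ (ρ γ f) = χ γ.2 ^ (Φ f).order * σ γ.1 (leadHom Φ f))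
    (hroot : ∀ (u : F) (n : ℕ), 0 < n → u ^ n = 1 → ∀ g, σ g u = u)
    (hC : (Nat.card C : F) ≠ 0) (hZ : ∀ z ∈ Subgroup.center G, z ^ Nat.card C = 1)
    (hG : ∀ W : Subgroup G, W.Normal → W ≠ ⊥ → ∃ w ∈ W, w ≠ 1 ∧ (orderOf w : F) ≠ 0)
    {E : IntermediateField K L} (hE : Compresses ρ E) :
    Compresses σ (adjoin K (residues (residueMapGraph Φ hΦ) E)) ∧
      ∃ x ∈ E, x ≠ 0 ∧ (x, (0 : F)) ∈ residueMapGraph Φ hΦ := by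
  classical
  set R := residues (residueMapGraph Φ hΦ) E with hR
  obtain ⟨π, hπ, hπ0, hgen⟩ := exists_order_generator Φ E
  set m := (Φ π).order with hm
  set l := leadHom Φ π with hl
  have hl0 : l ≠ 0 := (map_ne_zero _).2 hπ0
  have hχ0 : ∀ c, χ c ≠ 0 := fun c h ↦ by
    have := map_mul χ c c⁻¹
    rw [mul_inv_cancel, map_one, h, zero_mul] at this
    exact one_ne_zero this
  have hχ1 : ∀ c, χ c ^ Nat.card C = 1 := fun c ↦ by
    rw [← map_pow, pow_card_eq_one', map_one]
  have hlcG : ∀ g f, (Φ f).order = 0 → leadHom Φ (ρ (g, 1) f) = σ g (leadHom Φ f) :=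
    fun g f h ↦ by rw [hlc, h, zpow_zero, one_mul]
  have hΓ : ∀ g x y, (x, y) ∈ residueMapGraph Φ hΦ →
      (ρ (g, 1) x, σ g y) ∈ residueMapGraph Φ hΦ := fun g x y h ↦
    residueMapGraph_stable (hord _) (hlcG g) h
  have hRσ : ∀ g, ∀ y ∈ R, σ g y ∈ R := by
    rintro g y ⟨x, hx, hxy⟩
    exact ⟨_, hE.stable _ x hx, hΓ g x y hxy⟩
  -- an element acting trivially on all leading coefficients is trivial
  have key : ∀ (g : G) (c : C) (ℓ : ℕ), (∀ y ∈ R, σ g y = y) → χ c ^ m * σ g l = l →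
      (g, c) ^ ℓ = 1 → (ℓ : F) ≠ 0 → (g, c) = 1 := by
    intro g c ℓ hg hgc hpow hℓ
    refine hE.faithful _ fun x hx ↦ eq_self_of_leadingCoeff_eq (ℓ := ℓ) (Φ := Φ) (hE.stable _)
      (by rw [← map_pow, hpow, map_one]) hℓ (fun f _ ↦ hord _ f) (fun f hf ↦ ?_) x hx
    rcases eq_or_ne f 0 with rfl | hf0
    · rw [map_zero]
    -- Up to a power of π, f has order zero. Its leading coefficient is then a residue of E times a
    -- power of l.
    obtain ⟨k, hk⟩ := hgen f hf hf0
    have hπk : π ^ k ≠ 0 := zpow_ne_zero _ hπ0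
    have hu : (Φ (f / π ^ k)).order = 0 := by
      rw [order_map_div Φ hf0 hπk, order_map_zpow Φ hπ0, hk, sub_self]
    have h1 : leadHom Φ (ρ (g, c) (f / π ^ k)) = leadHom Φ (f / π ^ k) := by
      rw [hlc, hu, zpow_zero, one_mul]
      exact hg _ (leadHom_mem_residues (div_mem hf (zpow_mem hπ k)) hu)
    have h2 : leadHom Φ (ρ (g, c) (π ^ k)) = leadHom Φ (π ^ k) := by
      rw [map_zpow₀, map_zpow₀, map_zpow₀, hlc]
      exact congrArg (· ^ k) hgc
    rw [← div_mul_cancel₀ f hπk, map_mul, map_mul, h1, h2, map_mul]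
  -- If the valuation were trivial on E, then C would fix all leading coefficients and hence act
  -- trivially.
  have hm0 : m ≠ 0 := fun h ↦ by
    obtain ⟨c, hc⟩ := exists_ne (1 : C)
    have := key 1 c (Nat.card C) (fun y _ ↦ by simp) (by simp [h])
      (by rw [Prod.pow_mk, pow_card_eq_one', one_pow]; rfl) hC
    exact hc (Prod.ext_iff.1 this).2
  -- The kernel of the action of G on the residues, which has to be shown trivial.
  let N : Subgroup G :=
    { carrier := {n | ∀ y ∈ R, σ n y = y}
      one_mem' := fun y _ ↦ by simp
      mul_mem' := fun {a b} ha hb y hy ↦ by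
        rw [map_mul, AlgEquiv.mul_apply, hb y hy, ha y hy]
      inv_mem' := fun {a} ha y hy ↦ by
        conv_lhs => rw [← ha y hy]
        rw [← AlgEquiv.mul_apply, ← map_mul, inv_mul_cancel, map_one, AlgEquiv.one_apply] }
  have hσinv : ∀ g x, σ g (σ g⁻¹ x) = x := fun g x ↦ by
    rw [← AlgEquiv.mul_apply, ← map_mul, mul_inv_cancel, map_one, AlgEquiv.one_apply]
  have hNnormal : ∀ n ∈ N, ∀ g, g * n * g⁻¹ ∈ N := fun n hn g y hy ↦ by
    rw [map_mul, map_mul, AlgEquiv.mul_apply, AlgEquiv.mul_apply, hn _ (hRσ _ y hy), hσinv]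
  have hw : ∀ g, σ g l / l ∈ R := fun g ↦ by
    have h0 : ρ (g, 1) π ≠ 0 := (map_ne_zero _).2 hπ0
    have h1 : (Φ (ρ (g, 1) π / π)).order = 0 := by rw [order_map_div Φ h0 hπ0, hord, sub_self]
    have h2 := leadHom_mem_residues (hΦ := hΦ) (div_mem (hE.stable (g, 1) π hπ) hπ) h1
    rwa [map_div₀, hlc, map_one, one_zpow, one_mul] at h2
  let θ : G → F := fun g ↦ σ g l / l
  have hθ : ∀ g, σ g l = θ g * l := fun g ↦ (div_mul_cancel₀ _ hl0).symm
  have hθpow : ∀ n ∈ N, ∀ k : ℕ, σ (n ^ k) l = θ n ^ k * l := fun n hn k ↦ by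
    induction k with
    | zero => simp
    | succ k ih =>
      rw [pow_succ, map_mul, AlgEquiv.mul_apply, hθ, map_mul, ih, (N.pow_mem hn k) _ (hw n)]
      ring
  have hθroot : ∀ n ∈ N, ∀ k : ℕ, n ^ k = 1 → θ n ^ k = 1 := fun n hn k hk ↦ by
    have := hθpow n hn k
    rw [hk, map_one, AlgEquiv.one_apply] at this
    exact mul_right_cancel₀ hl0 (this.symm.trans (one_mul l).symm)
  -- θ n is a root of unity, so G fixes it. Conjugate elements of N therefore multiply l by the same
  -- factor.
  have hθconj : ∀ n ∈ N, ∀ g, σ (g * n * g⁻¹) l = σ n l := fun n hn g ↦ by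
    have h1 : σ n (σ g⁻¹ l) = θ n * σ g⁻¹ l := by
      rw [hθ g⁻¹, map_mul, hn _ (hw _), hθ n]
      ring
    rw [map_mul, map_mul, AlgEquiv.mul_apply, AlgEquiv.mul_apply, h1, map_mul, hσinv,
      hroot (θ n) _ (orderOf_pos n) (hθroot n hn _ (pow_orderOf_eq_one n)), hθ n]
  -- W fixes the residues and l, hence all leading coefficients of E. As W is normal, it would
  -- otherwise contain a nontrivial element to which `key` applies.
  let W : Subgroup G := N ⊓
    { carrier := {n | σ n l = l}
      one_mem' := by simp
      mul_mem' := fun {a b} (ha : σ a l = l) (hb : σ b l = l) ↦ by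
        change σ (a * b) l = l
        rw [map_mul, AlgEquiv.mul_apply, hb, ha]
      inv_mem' := fun {a} (ha : σ a l = l) ↦ by
        change σ a⁻¹ l = l
        conv_lhs => rw [← ha]
        rw [← AlgEquiv.mul_apply, ← map_mul, inv_mul_cancel, map_one, AlgEquiv.one_apply] }
  have hW : W = ⊥ := by
    by_contra hW
    obtain ⟨w, hw, hw1, hw2⟩ := hG W ⟨fun n hn g ↦
      ⟨hNnormal n hn.1 g, (hθconj n hn.1 g).trans hn.2⟩⟩ hW
    have := key w 1 (orderOf w) hw.1
      (by rw [map_one, one_zpow, one_mul]; exact hw.2)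
      (by rw [Prod.pow_mk, pow_orderOf_eq_one, one_pow]; rfl) hw2
    exact hw1 (Prod.ext_iff.1 this).1
  -- The commutator of n with any g lies in N and fixes l, so it lies in W = 1.
  have hNcenter : N ≤ Subgroup.center G := fun n hn ↦ by
    rw [Subgroup.mem_center_iff]
    intro g
    have h1 : n⁻¹ * (g * n * g⁻¹) ∈ W := by
      refine ⟨N.mul_mem (N.inv_mem hn) (hNnormal n hn g), ?_⟩
      change σ (n⁻¹ * (g * n * g⁻¹)) l = l
      rw [map_mul, AlgEquiv.mul_apply, hθconj n hn, ← AlgEquiv.mul_apply, ← map_mul,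
        inv_mul_cancel, map_one, AlgEquiv.one_apply]
    rw [hW, Subgroup.mem_bot, inv_mul_eq_one] at h1
    conv_rhs => rw [h1]
    group
  -- the values of `χ ^ m` are all the roots of unity of the order of `C`
  have hχm : ∀ u : F, u ^ Nat.card C = 1 → ∃ c, χ c ^ m = u := by
    have := Fintype.ofFinite C
    -- Since c ↦ χ(c)^m is injective, its |C| values exhaust the at most |C| roots of unity of
    -- exponent |C|.
    have hinj : Function.Injective fun c ↦ χ c ^ m := by
      intro c d (hcd : χ c ^ m = χ d ^ m)
      have h2 : χ (c * d⁻¹) ^ m = 1 := by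
        have h3 : χ (c * d⁻¹) * χ d = χ c := by rw [← map_mul, inv_mul_cancel_right]
        rw [← h3, mul_zpow] at hcd
        exact mul_right_cancel₀ (zpow_ne_zero m (hχ0 d)) (hcd.trans (one_mul _).symm)
      have := key 1 (c * d⁻¹) (Nat.card C) (fun y _ ↦ by simp) (by rw [h2]; simp)
        (by rw [Prod.pow_mk, pow_card_eq_one', one_pow]; rfl) hC
      exact mul_inv_eq_one.1 (Prod.ext_iff.1 this).2
    have hpos : 0 < Nat.card C := Nat.card_pos
    have hsub : (Finset.univ.image fun c ↦ χ c ^ m) ⊆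
        Polynomial.nthRootsFinset (Nat.card C) (1 : F) := by
      intro x hx
      obtain ⟨c, -, rfl⟩ := Finset.mem_image.1 hx
      rw [Polynomial.mem_nthRootsFinset hpos, ← zpow_natCast, ← zpow_mul, mul_comm, zpow_mul,
        zpow_natCast, hχ1, one_zpow]
    have hcard : (Polynomial.nthRootsFinset (Nat.card C) (1 : F)).card ≤
        (Finset.univ.image fun c ↦ χ c ^ m).card := by
      rw [Finset.card_image_of_injective _ hinj, Finset.card_univ, ← Nat.card_eq_fintype_card]
      exact (Multiset.toFinset_card_le _).trans (Polynomial.card_nthRoots _ _)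
    intro u hu
    have hu' : u ∈ Finset.univ.image fun c ↦ χ c ^ m := by
      rw [Finset.eq_of_subset_of_card_le hsub hcard, Polynomial.mem_nthRootsFinset hpos, hu]
    obtain ⟨c, -, hc⟩ := Finset.mem_image.1 hu'
    exact ⟨c, hc⟩
  refine ⟨Compresses.adjoin_residues (ρ := ρ.comp (MonoidHom.inl G C)) hΓ
    (fun g ↦ hE.stable (g, 1)) fun n hn ↦ ?_, ?_⟩
  · have hnq := hZ n (hNcenter hn)
    -- The factor χ(c)^m cancels θ n, so (n, c) fixes all leading coefficients and is trivial.
    obtain ⟨c, hc⟩ := hχm (θ n)⁻¹ (by rw [inv_pow, hθroot n hn _ hnq, inv_one])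
    have := key n c (Nat.card C) hn (by
        have hθ0 : θ n ≠ 0 := div_ne_zero ((map_ne_zero _).2 hl0) hl0
        rw [hc, hθ n, inv_mul_cancel_left₀ hθ0])
      (by rw [Prod.pow_mk, pow_card_eq_one', hnq]; rfl) hC
    exact (Prod.ext_iff.1 this).1
  · obtain ⟨e, he, he0, hpos⟩ : ∃ e ∈ E, e ≠ 0 ∧ 0 < (Φ e).order := by
      -- The generator π of the value group may have negative order. Then its inverse has residue
      -- zero.
      rcases lt_or_gt_of_ne hm0 with h | h
      · exact ⟨π ^ (-1 : ℤ), zpow_mem hπ _, zpow_ne_zero _ hπ0, by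
          rw [order_map_zpow Φ hπ0]
          omega⟩
      · exact ⟨π, hπ, hπ0, h⟩
    exact ⟨e, he, he0, mem_residueMapGraph.2 ⟨hpos.le, by
      rw [coeff_zero_of_order_nonneg hpos.le, if_neg hpos.ne']⟩⟩

end Laurent
end EssDim

namespace EssDim
open IntermediateField

/-! ### Eigenspace decomposition under C -/

section Coaction

variable {K : Type*} [Field K] {G C : Type*} [Group C]

/-- The decomposition of the regular representation of `G × C` into eigenspaces of `C`, as a
homomorphism to polynomials in a new variable `t` which sends eigenvectors for the `i`-th power of
`χ` to multiples of `t ^ i`. -/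
noncomputable def coaction (G : Type*) [Fintype C] (χ : C →* Kˣ) :
    MvPolynomial (G × C) K →ₐ[K] Polynomial (MvPolynomial (G × C) K) :=
  MvPolynomial.aeval fun x ↦ ∑ i ∈ Finset.range (Fintype.card C), ∑ c : C,
    Polynomial.monomial i
      (MvPolynomial.C ((Fintype.card C : K)⁻¹ * (χ (x.2 * c⁻¹) : K) ^ i) *
        MvPolynomial.X (x.1, c))

theorem sum_pow_character [Fintype C] [DecidableEq C] {χ : C →* Kˣ} (hχ : Function.Injective χ) (c : C) :
    ∑ i ∈ Finset.range (Fintype.card C), (χ c : K) ^ i =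
      if c = 1 then (Fintype.card C : K) else 0 := by
  split_ifs with h
  · simp [h]
  · have h1 : (χ c : K) ≠ 1 := fun h1 ↦ h (hχ (by rw [map_one]; exact Units.ext h1))
    rw [geom_sum_eq h1, ← Units.val_pow_eq_pow_val, ← map_pow, pow_card_eq_one]
    simp

/-- At t = 1 the eigencomponents of each variable add up to that variable, by orthogonality of
characters and invertibility of |C|. This left inverse yields injectivity. -/
theorem eval_one_coaction [Fintype C] {χ : C →* Kˣ} (hχ : Function.Injective χ)
    (hC : (Fintype.card C : K) ≠ 0) (P : MvPolynomial (G × C) K) :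
    (coaction G χ P).eval 1 = P := by
  classical
  have : (((Polynomial.aeval (1 : MvPolynomial (G × C) K)).restrictScalars K).comp
      (coaction G χ)) = AlgHom.id K _ := by
    ext1 x
    simp only [coaction, AlgHom.comp_apply, MvPolynomial.aeval_X, AlgHom.restrictScalars_apply,
      map_sum, Polynomial.aeval_monomial, one_pow, mul_one, Algebra.algebraMap_self, RingHom.id_apply,
      AlgHom.id_apply]
    rw [Finset.sum_comm]
    simp only [← Finset.sum_mul, ← map_sum, ← Finset.mul_sum]
    rw [Finset.sum_eq_single x.2]
    · rw [sum_pow_character hχ, if_pos (mul_inv_cancel x.2), inv_mul_cancel₀ hC]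
      simp
    · intro c _ hc
      rw [sum_pow_character hχ, if_neg fun h ↦ hc (mul_inv_eq_one.1 h).symm]
      simp
    · simp
  have h := AlgHom.congr_fun this P
  simpa [Polynomial.aeval_def] using h

theorem coaction_injective [Fintype C] {χ : C →* Kˣ} (hχ : Function.Injective χ)
    (hC : (Fintype.card C : K) ≠ 0) : Function.Injective (coaction G χ) :=
  Function.LeftInverse.injective (g := Polynomial.eval 1) fun P ↦ eval_one_coaction hχ hC P

theorem coeff_coaction_rename [Group G] [Fintype C] (χ : C →* Kˣ) (γ : G × C)
    (P : MvPolynomial (G × C) K) (k : ℕ) :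
    (coaction G χ (MvPolynomial.rename (γ * ·) P)).coeff k =
      MvPolynomial.C ((χ γ.2 : K) ^ k) *
        MvPolynomial.rename ((γ.1, 1) * ·) ((coaction G χ P).coeff k) := by
  -- The substitution t ↦ χ(γ.2) t combined with the action of (γ.1, 1) on coefficients. It suffices
  -- to compare both sides on constants and variables.
  let T : Polynomial (MvPolynomial (G × C) K) →+* Polynomial (MvPolynomial (G × C) K) :=
    (Polynomial.compRingHom (Polynomial.C (MvPolynomial.C (χ γ.2 : K)) * Polynomial.X)).comp
      (Polynomial.mapRingHom
        (MvPolynomial.rename (R := K) ((γ.1, 1) * · : G × C → G × C)).toRingHom)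
  have hT : ∀ p k, (T p).coeff k = MvPolynomial.C ((χ γ.2 : K) ^ k) *
      MvPolynomial.rename ((γ.1, 1) * ·) (p.coeff k) := fun p k ↦ by
    simp only [T, RingHom.comp_apply, Polynomial.coe_compRingHom_apply,
      Polynomial.comp_C_mul_X_coeff, Polynomial.coe_mapRingHom, Polynomial.coeff_map]
    rw [mul_comm, map_pow]
    rfl
  have h : ((coaction G χ).comp (MvPolynomial.rename (γ * ·))).toRingHom =
      T.comp (coaction G χ).toRingHom := by
    apply MvPolynomial.ringHom_ext
    · intro r
      ext1 k
      simp only [AlgHom.toRingHom_eq_coe, RingHom.coe_coe, RingHom.comp_apply, AlgHom.comp_apply,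
        hT]
      simp only [← MvPolynomial.algebraMap_eq, AlgHom.commutes]
      rw [Polynomial.algebraMap_apply, Polynomial.coeff_C]
      split_ifs with hk
      · simp [hk]
      · simp
    · intro x
      ext1 k
      simp only [AlgHom.toRingHom_eq_coe, RingHom.coe_coe, RingHom.comp_apply, AlgHom.comp_apply,
        hT, MvPolynomial.rename_X]
      simp only [coaction, MvPolynomial.aeval_X, Polynomial.finsetSum_coeff,
        Polynomial.coeff_monomial]
      rw [map_sum, Finset.mul_sum]
      refine Finset.sum_congr rfl fun i _ ↦ ?_
      rw [map_sum, Finset.mul_sum]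
      refine Finset.sum_congr rfl fun c _ ↦ ?_
      split_ifs with hi
      · subst hi
        rw [map_mul (MvPolynomial.rename _), MvPolynomial.rename_C, MvPolynomial.rename_X]
        simp only [Prod.snd_mul, Prod.fst_mul, Prod.mk_mul_mk, one_mul, map_mul, Units.val_mul,
          mul_pow, mul_assoc]
        ring
      · rw [map_zero, mul_zero]
  rw [← hT]
  exact congrArg (fun p ↦ Polynomial.coeff p k) (RingHom.congr_fun h P)

end Coaction
end EssDim

namespace EssDim
open IntermediateField

/-- Such a change of coefficients preserves the support. -/
theorem order_and_leadingCoeff_of_coeff {F : Type*} [Field F] {x y : LaurentSeries F} {u : F}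
    (hu : u ≠ 0) (τ : F →+* F) (h : ∀ n, y.coeff n = u ^ n * τ (x.coeff n)) :
    y.order = x.order ∧ y.leadingCoeff = u ^ x.order * τ x.leadingCoeff := by
  have hz : ∀ n, y.coeff n = 0 ↔ x.coeff n = 0 := fun n ↦ by
    rw [h, mul_eq_zero, or_iff_right (zpow_ne_zero n hu), map_eq_zero]
  have hord : y.order = x.order := by
    rcases eq_or_ne x 0 with rfl | hx
    · have : y = 0 := by
        ext n
        exact (hz n).2 rfl
      rw [this]
    · have hy : y ≠ 0 := fun hy ↦ hx <| by
        ext n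
        exact (hz n).1 (by rw [hy]; rfl)
      refine le_antisymm (HahnSeries.order_le_of_coeff_ne_zero fun h0 ↦ ?_)
        (HahnSeries.order_le_of_coeff_ne_zero fun h0 ↦ ?_)
      · rw [hz, ← HahnSeries.leadingCoeff_eq] at h0
        exact HahnSeries.leadingCoeff_ne_zero.2 hx h0
      · rw [← hz, ← HahnSeries.leadingCoeff_eq] at h0
        exact HahnSeries.leadingCoeff_ne_zero.2 hy h0
  exact ⟨hord, by rw [HahnSeries.leadingCoeff_eq, HahnSeries.leadingCoeff_eq, hord, h]⟩

section Constants

variable {K : Type*} [Field K] {X : Type*}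

/-- A field of rational functions over `K` contains no elements algebraic over `K` besides
constants. -/
theorem exists_algebraMap_eq_of_isAlgebraic {u : RegField K X} (hu : IsAlgebraic K u) :
    ∃ r : K, algebraMap K (RegField K X) r = u := by
  rcases eq_or_ne u 0 with rfl | hu0
  · exact ⟨0, map_zero _⟩
  -- Both u and its inverse are integral over the integrally closed polynomial ring. So u is a unit
  -- polynomial, that is, a constant.
  obtain ⟨p, hp⟩ := IsIntegrallyClosed.isIntegral_iff.1
    (hu.isIntegral.tower_top (A := MvPolynomial X K))
  obtain ⟨q, hq⟩ := IsIntegrallyClosed.isIntegral_iff.1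
    (hu.inv.isIntegral.tower_top (A := MvPolynomial X K))
  have hpq : p * q = 1 := IsFractionRing.injective (MvPolynomial X K) (RegField K X) <| by
    rw [map_mul, hp, hq, map_one, mul_inv_cancel₀ hu0]
  obtain ⟨r, -, rfl⟩ := MvPolynomial.isUnit_iff_eq_C_of_isReduced.1 (IsUnit.of_mul_eq_one q hpq)
  exact ⟨r, (IsScalarTower.algebraMap_apply K (MvPolynomial X K) (RegField K X) r).trans hp⟩

end Constants

/-! ### The equivariant embedding into Laurent series -/

section Coaction

variable {K : Type*} [Field K] {G C : Type*} [Group C] [Fintype C]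

/-- The homomorphism `coaction` with values in the Laurent series over the function field. -/
noncomputable def coactionLaurent (G : Type*) (χ : C →* Kˣ) :
    MvPolynomial (G × C) K →+* LaurentSeries (RegField K (G × C)) :=
  (HahnSeries.ofPowerSeries ℤ (RegField K (G × C))).comp
    (Polynomial.coeToPowerSeries.ringHom.comp
      ((Polynomial.mapRingHom (algebraMap (MvPolynomial (G × C) K) (RegField K (G × C)))).comp
        (coaction G χ).toRingHom))

theorem coeff_coactionLaurent (χ : C →* Kˣ) (P : MvPolynomial (G × C) K) (n : ℤ) :
    (coactionLaurent G χ P).coeff n =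
      if n < 0 then 0 else algebraMap _ (RegField K (G × C)) ((coaction G χ P).coeff n.natAbs) := by
  refine (PowerSeries.coeff_coe _ n).trans ?_
  split_ifs
  · rfl
  · simp

theorem coactionLaurent_injective {χ : C →* Kˣ} (hχ : Function.Injective χ)
    (hC : (Fintype.card C : K) ≠ 0) : Function.Injective (coactionLaurent G χ) := by
  simp only [coactionLaurent, RingHom.coe_comp]
  exact HahnSeries.ofPowerSeries_injective.comp ((Polynomial.coe_injective _).comp
    ((Polynomial.map_injective _ (IsFractionRing.injective _ _)).comp (coaction_injective hχ hC)))

/-- The embedding of the function field of the regular representation of `G × C` into a field of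
Laurent series, on which `C` acts by multiplying the variable with the values of `χ`. -/
noncomputable def laurentEmbedding (G : Type*) {χ : C →* Kˣ} (hχ : Function.Injective χ)
    (hC : (Fintype.card C : K) ≠ 0) :
    RegField K (G × C) →+* LaurentSeries (RegField K (G × C)) :=
  IsFractionRing.lift (coactionLaurent_injective (G := G) hχ hC)

variable {χ : C →* Kˣ} (hχ : Function.Injective χ) (hC : (Fintype.card C : K) ≠ 0)

theorem laurentEmbedding_algebraMap_mvPolynomial (P : MvPolynomial (G × C) K) :
    laurentEmbedding G hχ hC (algebraMap _ _ P) = coactionLaurent G χ P :=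
  IsFractionRing.lift_algebraMap _ _

theorem laurentEmbedding_algebraMap (r : K) :
    laurentEmbedding G hχ hC (algebraMap K _ r) =
      HahnSeries.C (algebraMap K (RegField K (G × C)) r) := by
  rw [IsScalarTower.algebraMap_apply K (MvPolynomial (G × C) K),
    laurentEmbedding_algebraMap_mvPolynomial, ← HahnSeries.ofPowerSeries_C]
  change HahnSeries.ofPowerSeries ℤ _ _ = _
  congr 1
  simp only [RingHom.comp_apply]
  have : (coaction G χ).toRingHom (algebraMap K (MvPolynomial (G × C) K) r) =
      Polynomial.C (algebraMap K (MvPolynomial (G × C) K) r) := (coaction G χ).commutes r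
  rw [this]
  simp

variable [Group G]

/-- For polynomials this is the coefficient formula of `coeff_coaction_rename`. It passes to
fractions because order is additive and leading coefficients are multiplicative. -/
theorem laurentEmbedding_regAction (γ : G × C) (f : RegField K (G × C)) :
    (laurentEmbedding G hχ hC (regAction K (G × C) γ f)).order =
        (laurentEmbedding G hχ hC f).order ∧
      (laurentEmbedding G hχ hC (regAction K (G × C) γ f)).leadingCoeff =
        algebraMap K (RegField K (G × C)) (χ γ.2) ^ (laurentEmbedding G hχ hC f).order *
          regAction K (G × C) (γ.1, 1) (laurentEmbedding G hχ hC f).leadingCoeff := by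
  set Φ := laurentEmbedding G hχ hC
  have hu : algebraMap K (RegField K (G × C)) (χ γ.2) ≠ 0 := by simp
  have hreg : ∀ (δ : G × C) (P : MvPolynomial (G × C) K), regAction K (G × C) δ
      (algebraMap _ _ P) = algebraMap _ (RegField K (G × C)) (MvPolynomial.rename (δ * ·) P) :=
    fun δ P ↦ by
      rw [regAction_eq_permAction]
      exact permAction_algebraMap _ _ _
  have hpoly : ∀ P : MvPolynomial (G × C) K,
      (Φ (regAction K (G × C) γ (algebraMap _ _ P))).order = (Φ (algebraMap _ _ P)).order ∧
      (Φ (regAction K (G × C) γ (algebraMap _ _ P))).leadingCoeff =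
        algebraMap K (RegField K (G × C)) (χ γ.2) ^ (Φ (algebraMap _ _ P)).order *
          regAction K (G × C) (γ.1, 1) (Φ (algebraMap _ _ P)).leadingCoeff := fun P ↦ by
    refine order_and_leadingCoeff_of_coeff hu
      (regAction K (G × C) (γ.1, 1) : RegField K (G × C) →+* RegField K (G × C)) fun n ↦ ?_
    rw [hreg, laurentEmbedding_algebraMap_mvPolynomial, laurentEmbedding_algebraMap_mvPolynomial,
      coeff_coactionLaurent, coeff_coactionLaurent]
    split_ifs with hn
    · simp
    · obtain ⟨k, rfl⟩ := Int.eq_ofNat_of_zero_le (not_lt.1 hn)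
      rw [Int.natAbs_natCast, zpow_natCast, coeff_coaction_rename, map_mul]
      refine congrArg₂ _ ?_ (hreg _ _).symm
      rw [← map_pow, IsScalarTower.algebraMap_apply K (MvPolynomial (G × C) K)
        (RegField K (G × C))]
      rfl
  obtain ⟨a, b, hb, rfl⟩ := IsFractionRing.div_surjective (A := MvPolynomial (G × C) K) f
  have hb0 : algebraMap _ (RegField K (G × C)) b ≠ 0 :=
    (map_ne_zero_iff _ (IsFractionRing.injective _ _)).2 (nonZeroDivisors.ne_zero hb)
  rcases eq_or_ne (algebraMap _ (RegField K (G × C)) a) 0 with ha0 | ha0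
  · simp [ha0]
  have ha0' := (map_ne_zero (regAction K (G × C) γ)).2 ha0
  have hb0' := (map_ne_zero (regAction K (G × C) γ)).2 hb0
  refine ⟨?_, ?_⟩
  · rw [map_div₀, order_map_div Φ ha0' hb0', order_map_div Φ ha0 hb0, (hpoly a).1, (hpoly b).1]
  · have h1 := fun f ↦ leadHom_apply Φ f
    rw [order_map_div Φ ha0 hb0, zpow_sub₀ hu]
    simp only [← h1] at hpoly ⊢
    rw [map_div₀, map_div₀, map_div₀, map_div₀, (hpoly a).2, (hpoly b).2, mul_div_mul_comm]

end Coaction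

/-! ### The inequality for a product with a group of roots of unity -/

section Main

variable {K : Type*} [Field K] {G C : Type*} [Group G] [Group C]

/-- If every nontrivial normal subgroup of `G` has an element of order prime to the characteristic,
and the center of `G` is killed by the order of the group `C` of roots of unity of `K`, then
`ed (G × C) ≥ ed G + 1`. -/
theorem ed_add_one_le_ed_prod [Finite G] [Finite C] [Nontrivial C] {χ : C →* Kˣ}
    (hχ : Function.Injective χ) (hC : (Nat.card C : K) ≠ 0)
    (hZ : ∀ z ∈ Subgroup.center G, z ^ Nat.card C = 1)
    (hG : ∀ W : Subgroup G, W.Normal → W ≠ ⊥ → ∃ w ∈ W, w ≠ 1 ∧ (orderOf w : K) ≠ 0) :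
    ed K G + 1 ≤ ed K (G × C) := by
  have := Fintype.ofFinite C
  have hC' : (Fintype.card C : K) ≠ 0 := by rwa [← Nat.card_eq_fintype_card]
  have hcast : ∀ n : ℕ, (n : K) ≠ 0 → (n : RegField K (G × C)) ≠ 0 := fun n hn ↦ by
    rw [← map_natCast (algebraMap K (RegField K (G × C)))]
    exact (map_ne_zero _).2 hn
  obtain ⟨E, hE, htr⟩ := exists_compresses_trdeg_eq_ed K (G × C)
  let Φ := laurentEmbedding G hχ hC'
  have hΦ : ∀ r, Φ (algebraMap K _ r) = HahnSeries.C (algebraMap K (RegField K (G × C)) r) :=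
    laurentEmbedding_algebraMap hχ hC'
  -- The residues lie in K(x_γ : γ ∈ G × C), where G permutes the variables freely by left
  -- translation.
  let a : G →* Equiv.Perm (G × C) :=
    (MulAction.toPermHom (G × C) (G × C)).comp (MonoidHom.inl G C)
  let χ' : C →* RegField K (G × C) :=
    ((algebraMap K (RegField K (G × C)) : K →* RegField K (G × C)).comp (Units.coeHom K)).comp χ
  obtain ⟨hcomp, x, hx, hx0, hxΓ⟩ := compresses_residueField (Φ := Φ) (hΦ := hΦ)
    (ρ := regAction K (G × C)) (σ := permAction K a) (χ := χ')
    (fun γ f ↦ (laurentEmbedding_regAction hχ hC' γ f).1)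
    (fun γ f ↦ (laurentEmbedding_regAction hχ hC' γ f).2)
    (fun u n hn hu g ↦ by
      obtain ⟨r, rfl⟩ := exists_algebraMap_eq_of_isAlgebraic
        (IsIntegral.of_pow hn (hu ▸ isIntegral_one)).isAlgebraic
      exact (permAction K a g).commutes r)
    (hcast _ hC) hZ
    (fun W hW hW' ↦ by
      obtain ⟨w, hw, hw1, hw2⟩ := hG W hW hW'
      exact ⟨w, hw, hw1, hcast _ hw2⟩) hE
  have h1 := lift_trdeg_residues_add_one_le
    (fun y hy ↦ eq_zero_of_mem_residueMapGraph (Φ := Φ) (hΦ := hΦ) hy) E hx hx0 hxΓ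
  rw [htr] at h1
  simp only [Cardinal.lift_id] at h1
  obtain ⟨d, hd⟩ := Cardinal.lt_aleph0.1
    ((le_self_add.trans h1).trans_lt (Cardinal.natCast_lt_aleph0 (n := ed K (G × C))))
  have h2 := ed_le_of_compresses_permAction (a := a) (fun g x hx ↦ ?_) hcomp hd.le
  · rw [hd] at h1
    have h3 : d + 1 ≤ ed K (G × C) := by exact_mod_cast h1
    omega
  · have : g * x.1 = x.1 := congrArg Prod.fst hx
    exact mul_eq_right.1 this

end Main
end EssDim

namespace EssDim
open IntermediateField

/-- A compression of transcendence degree zero would consist of constants, on which G acts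
trivially. -/
theorem one_le_ed {K G : Type*} [Field K] [Group G] [Finite G] [Nontrivial G] : 1 ≤ ed K G := by
  obtain ⟨E, hE, htr⟩ := exists_compresses_trdeg_eq_ed K G
  by_contra! h
  have h0 : ed K G = 0 := by omega
  rw [h0, Nat.cast_zero, trdeg_eq_zero_iff] at htr
  obtain ⟨g, hg⟩ := exists_ne (1 : G)
  refine hg (hE.faithful g fun x hx ↦ ?_)
  obtain ⟨r, rfl⟩ := exists_algebraMap_eq_of_isAlgebraic
    ((htr.isAlgebraic (⟨x, hx⟩ : E)).algHom E.val)
  exact (regAction K G g).commutes r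

theorem trdeg_adjoin_le_mk {K M : Type*} [Field K] [Field M] [Algebra K M] (S : Set M) :
    Algebra.trdeg K (adjoin K S) ≤ Cardinal.mk S := by
  rw [trdeg_adjoin_eq]
  let T : Set (Algebra.adjoin K S) := Subtype.val ⁻¹' S
  have hT : Algebra.adjoin K T = ⊤ := Algebra.adjoin_adjoin_coe_preimage
  have : Algebra.IsAlgebraic (Algebra.adjoin K T) (Algebra.adjoin K S) := ⟨fun x ↦
    isAlgebraic_algebraMap (⟨x, hT ▸ Algebra.mem_top⟩ : Algebra.adjoin K T)⟩
  exact (Algebra.IsAlgebraic.trdeg_le_cardinalMk K (s := T)).trans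
    (Cardinal.mk_preimage_of_injective _ _ Subtype.val_injective)

/-! ### Extension of the base field -/

section BaseChange

variable {K K' G : Type*} [Field K] [Field K'] [Algebra K K']

/-- The extension of scalars of rational functions. -/
noncomputable def scalarExtension (K K' G : Type*) [Field K] [Field K'] [Algebra K K'] :
    RegField K G →+* RegField K' G :=
  IsFractionRing.lift (A := MvPolynomial G K) (g := (algebraMap (MvPolynomial G K') (RegField K' G)).comp
    (MvPolynomial.map (algebraMap K K'))) <| by
      rw [RingHom.coe_comp]
      exact (IsFractionRing.injective _ _).comp
        (MvPolynomial.map_injective _ (algebraMap K K').injective)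

theorem scalarExtension_algebraMap (p : MvPolynomial G K) :
    scalarExtension K K' G (algebraMap _ _ p) =
      algebraMap _ (RegField K' G) (MvPolynomial.map (algebraMap K K') p) :=
  IsFractionRing.lift_algebraMap _ _

theorem scalarExtension_regAction [Group G] (g : G) (x : RegField K G) :
    scalarExtension K K' G (regAction K G g x) =
      regAction K' G g (scalarExtension K K' G x) := by
  obtain ⟨a, b, -, rfl⟩ := IsFractionRing.div_surjective (A := MvPolynomial G K) x
  rw [regAction_eq_permAction, regAction_eq_permAction]
  simp only [map_div₀, permAction_algebraMap, scalarExtension_algebraMap, MvPolynomial.map_rename]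

theorem scalarExtension_mem_adjoin {S : Set (RegField K G)} {x : RegField K G}
    (hx : x ∈ Algebra.adjoin K S) :
    scalarExtension K K' G x ∈ adjoin K' (scalarExtension K K' G '' S) := by
  induction hx using Algebra.adjoin_induction with
  | mem x hx => exact subset_adjoin _ _ ⟨x, hx, rfl⟩
  | algebraMap r =>
    rw [IsScalarTower.algebraMap_apply K (MvPolynomial G K), scalarExtension_algebraMap,
      MvPolynomial.algebraMap_eq, MvPolynomial.map_C, ← MvPolynomial.algebraMap_eq,
      ← IsScalarTower.algebraMap_apply]
    exact IntermediateField.algebraMap_mem _ _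
  | add x y _ _ hx hy => rw [map_add]; exact add_mem hx hy
  | mul x y _ _ hx hy => rw [map_mul]; exact mul_mem hx hy

/-- The essential dimension does not grow under extension of the base field. -/
theorem ed_le_ed_of_algebra (K K' : Type*) [Field K] [Field K'] [Algebra K K'] [Group G]
    [Finite G] :
    ed K' G ≤ ed K G := by
  obtain ⟨E, hE, htr⟩ := exists_compresses_trdeg_eq_ed K G
  let ι := scalarExtension K K' G
  have : FaithfulSMul K E :=
    (faithfulSMul_iff_algebraMap_injective _ _).2 (algebraMap K E).injective
  obtain ⟨s, hs⟩ := exists_isTranscendenceBasis K E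
  -- The image of E generates over K' a field algebraic over the one generated by a transcendence
  -- basis of E. So the transcendence degree does not grow.
  let S : Set (RegField K G) := Subtype.val '' s
  have hle : adjoin K' (ι '' S) ≤ adjoin K' (ι '' (E : Set (RegField K G))) :=
    adjoin.mono _ _ _ (Set.image_mono (by rintro _ ⟨x, -, rfl⟩; exact x.2))
  have halg : ∀ x ∈ adjoin K' (ι '' (E : Set (RegField K G))),
      IsAlgebraic (adjoin K' (ι '' S)) x := by
    intro x hx
    induction hx using adjoin_induction with
    | mem y hy =>
      obtain ⟨e, he, rfl⟩ := hy
      have h1 : IsAlgebraic (Algebra.adjoin K (Set.range ((↑) : s → E))) (⟨e, he⟩ : E) :=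
        hs.isAlgebraic.isAlgebraic _
      have hmem : ∀ z : Algebra.adjoin K (Set.range ((↑) : s → E)),
          ι (z : E) ∈ adjoin K' (ι '' S) := fun z ↦ by
        refine scalarExtension_mem_adjoin ?_
        have h2 : (z : E).1 ∈ (Algebra.adjoin K (Set.range ((↑) : s → E))).map E.val :=
          ⟨z, z.2, rfl⟩
        rw [AlgHom.map_adjoin] at h2
        refine Algebra.adjoin_mono ?_ h2
        rintro _ ⟨_, ⟨y, rfl⟩, rfl⟩
        exact ⟨y, y.2, rfl⟩
      let f : Algebra.adjoin K (Set.range ((↑) : s → E)) →+* adjoin K' (ι '' S) :=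
        (ι.comp ((algebraMap E (RegField K G)).comp
          (algebraMap (Algebra.adjoin K (Set.range ((↑) : s → E))) E))).codRestrict
            (adjoin K' (ι '' S)) hmem
      exact h1.ringHom_of_comp_eq f (ι.comp (algebraMap E (RegField K G)))
        (fun a b hab ↦ Subtype.ext (Subtype.ext (ι.injective (congrArg Subtype.val hab)))) rfl
    | algebraMap r => exact isAlgebraic_algebraMap (algebraMap K' (adjoin K' (ι '' S)) r)
    | add x y _ _ hx hy => exact hx.add hy
    | mul x y _ _ hx hy => exact hx.mul hy
    | inv x _ hx => exact hx.inv
  have hcomp : Compresses (regAction K' G) (adjoin K' (ι '' (E : Set (RegField K G)))) := by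
    refine ⟨fun g x hx ↦ ?_, fun g hg ↦ hE.faithful g fun x hx ↦ ι.injective ?_⟩
    · have : adjoin K' (ι '' (E : Set (RegField K G))) ≤
          (adjoin K' (ι '' (E : Set (RegField K G)))).comap
            (regAction K' G g : RegField K' G →ₐ[K'] RegField K' G) := by
        rw [adjoin_le_iff]
        rintro _ ⟨x, hx, rfl⟩
        exact subset_adjoin K' _ ⟨_, hE.stable g x hx, scalarExtension_regAction g x⟩
      exact this hx
    · exact (scalarExtension_regAction g x).trans (hg _ (subset_adjoin K' _ ⟨x, hx, rfl⟩))
  refine ed_le_of_compresses hcomp ?_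
  rw [trdeg_eq_of_le_of_isAlgebraic hle halg]
  have h1 := trdeg_adjoin_le_mk (K := K') (ι '' S)
  have h2 : Cardinal.mk s = (ed K G : Cardinal) := hs.cardinalMk_eq_trdeg.trans htr
  have h3 := Cardinal.mk_image_le_lift (f := ι) (s := S)
  have h4 := (Cardinal.mk_image_le (f := ((↑) : E → RegField K G)) (s := s)).trans_eq h2
  have h5 := h3.trans (Cardinal.lift_le.2 h4)
  rw [Cardinal.lift_natCast] at h5
  exact h1.trans (by simpa using h5)

end BaseChange
end EssDim

namespace EssDim
open IntermediateField

/-! ### Generic points permuted by the group -/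

section Points

variable {K G X : Type*} [Field K] [Group G] [Fintype G] [DecidableEq X]

/-- The sum of the variables `x_g` with `g x₀ = x`: linear forms in the coordinate ring of the
regular representation which are permuted by `G` like the elements of `X`. -/
noncomputable def pointForm (K : Type*) [Field K] (a : G →* Equiv.Perm X) (x₀ x : X) :
    MvPolynomial G K :=
  ∑ g with a g x₀ = x, MvPolynomial.X g

theorem rename_pointForm (a : G →* Equiv.Perm X) (x₀ x : X) (g : G) :
    MvPolynomial.rename (g * ·) (pointForm K a x₀ x) = pointForm K a x₀ (a g x) := by
  rw [pointForm, pointForm, map_sum]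
  refine Finset.sum_bij (fun h _ ↦ g * h) ?_ ?_ ?_ ?_
  · simp
  · simp
  · intro h hh
    refine ⟨g⁻¹ * h, ?_, by simp⟩
    simp only [Finset.mem_filter, Finset.mem_univ, true_and] at hh ⊢
    rw [map_mul, map_inv, Equiv.Perm.mul_apply, hh]
    simp
  · simp

/-- For a transitive action the forms `pointForm` can take arbitrary values. -/
theorem exists_eval_pointForm (a : G →* Equiv.Perm X) (x₀ : X) (ha : ∀ x, ∃ g, a g x₀ = x)
    (b : X → K) : ∃ v : G → K, ∀ x, MvPolynomial.eval v (pointForm K a x₀ x) = b x := by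
  classical
  -- Setting to zero all variables except one in each fibre of g ↦ g x₀ leaves a single free
  -- variable in each form.
  choose t ht using ha
  refine ⟨fun g ↦ if g = t (a g x₀) then b (a g x₀) else 0, fun x ↦ ?_⟩
  rw [pointForm, map_sum, Finset.sum_eq_single (t x)]
  · simp [ht]
  · intro g hg hne
    simp only [Finset.mem_filter, Finset.mem_univ, true_and] at hg
    rw [MvPolynomial.eval_X, hg, if_neg hne]
  · simp [ht]

/-- The images of the forms `pointForm` in the function field. -/
noncomputable def point (K : Type*) [Field K] (a : G →* Equiv.Perm X) (x₀ x : X) : RegField K G :=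
  algebraMap _ _ (pointForm K a x₀ x)

theorem regAction_point (a : G →* Equiv.Perm X) (x₀ x : X) (g : G) :
    regAction K G g (point K a x₀ x) = point K a x₀ (a g x) := by
  rw [regAction_eq_permAction]
  refine (permAction_algebraMap _ _ _).trans ?_
  exact congrArg (algebraMap (MvPolynomial G K) (RegField K G)) (rename_pointForm a x₀ x g)

/-- The points are algebraically independent: a relation between them holds for all values. -/
theorem aeval_eq_of_aeval_point_eq {a : G →* Equiv.Perm X} {x₀ : X} (ha : ∀ x, ∃ g, a g x₀ = x)
    {P Q : MvPolynomial X K}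
    (h : MvPolynomial.aeval (point K a x₀) P = MvPolynomial.aeval (point K a x₀) Q) (b : X → K) :
    MvPolynomial.aeval b P = MvPolynomial.aeval b Q := by
  have hP : ∀ P : MvPolynomial X K, MvPolynomial.aeval (point K a x₀) P =
      algebraMap _ (RegField K G) (MvPolynomial.aeval (pointForm K a x₀) P) := fun P ↦
    (MvPolynomial.aeval_algebraMap_apply (RegField K G) (pointForm K a x₀) P)
  rw [hP, hP] at h
  have h' := IsFractionRing.injective (MvPolynomial G K) (RegField K G) h
  obtain ⟨v, hv⟩ := exists_eval_pointForm a x₀ ha b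
  have hv' : ∀ P : MvPolynomial X K, MvPolynomial.aeval v (MvPolynomial.aeval (pointForm K a x₀) P)
      = MvPolynomial.aeval b P := fun P ↦ by
    rw [← AlgHom.comp_apply, MvPolynomial.comp_aeval]
    congr 2
    ext x
    exact hv x
  rw [← hv', ← hv', h']

theorem point_ne_point {a : G →* Equiv.Perm X} {x₀ : X} (ha : ∀ x, ∃ g, a g x₀ = x) {x y : X}
    (hxy : x ≠ y) : point K a x₀ x ≠ point K a x₀ y := fun h ↦ by
  have := aeval_eq_of_aeval_point_eq (K := K) ha (P := MvPolynomial.X x) (Q := MvPolynomial.X y)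
    (by simpa using h) (fun z ↦ if z = x then 1 else 0)
  simp [hxy.symm] at this

end Points

/-- The kernel of the action on a stable subfield is normal, so moving a single element already
forces faithfulness. -/
theorem compresses_of_isSimpleGroup {K L G : Type*} [Field K] [Field L] [Algebra K L] [Group G]
    [IsSimpleGroup G] {ρ : G →* (L ≃ₐ[K] L)} {E : IntermediateField K L}
    (hE : ∀ g, ∀ x ∈ E, ρ g x ∈ E) {g : G} {x : L} (hx : x ∈ E) (hgx : ρ g x ≠ x) :
    Compresses ρ E := by
  refine ⟨hE, fun h hh ↦ ?_⟩
  let N : Subgroup G :=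
    { carrier := {n | ∀ y ∈ E, ρ n y = y}
      one_mem' := fun y _ ↦ by simp
      mul_mem' := fun {a b} ha hb y hy ↦ by
        rw [map_mul, AlgEquiv.mul_apply, hb y hy, ha y hy]
      inv_mem' := fun {a} ha y hy ↦ by
        conv_lhs => rw [← ha y hy]
        rw [← AlgEquiv.mul_apply, ← map_mul, inv_mul_cancel, map_one, AlgEquiv.one_apply] }
  have hN : N.Normal := ⟨fun n hn g y hy ↦ by
    rw [map_mul, map_mul, AlgEquiv.mul_apply, AlgEquiv.mul_apply, hn _ (hE _ y hy),
      ← AlgEquiv.mul_apply, ← map_mul, mul_inv_cancel, map_one, AlgEquiv.one_apply]⟩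
  rcases hN.eq_bot_or_eq_top with h1 | h1
  · have : h ∈ N := hh
    rwa [h1, Subgroup.mem_bot] at this
  · have : g ∈ N := h1 ▸ Subgroup.mem_top g
    exact absurd (this x hx) hgx

theorem adjoin_stable {K L G : Type*} [Field K] [Field L] [Algebra K L] [Group G]
    {ρ : G →* (L ≃ₐ[K] L)} {S : Set L} (hS : ∀ g, ∀ x ∈ S, ρ g x ∈ S) (g : G) :
    ∀ x ∈ adjoin K S, ρ g x ∈ adjoin K S := fun x hx ↦ by
  have : adjoin K S ≤ (adjoin K S).comap (ρ g : L →ₐ[K] L) := by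
    rw [adjoin_le_iff]
    exact fun x hx ↦ subset_adjoin K _ (hS g x hx)
  exact this hx

theorem trdeg_le_of_le_adjoin {K L : Type*} [Field K] [Field L] [Algebra K L]
    {E : IntermediateField K L} {S : Set L} (h : E ≤ adjoin K S) :
    Algebra.trdeg K E ≤ Cardinal.mk S :=
  (trdeg_le_of_injective (inclusion h) (inclusion_injective h)).trans (trdeg_adjoin_le_mk S)

theorem exists_alternatingGroup_apply_eq {n : ℕ} (hn : 3 ≤ n) (i j : Fin n) :
    ∃ g : alternatingGroup (Fin n), (alternatingGroup (Fin n)).subtype g i = j := by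
  have := alternatingGroup.isPretransitive_of_three_le_card (Fin n) (by simpa using hn)
  obtain ⟨g, hg⟩ := MulAction.exists_smul_eq (alternatingGroup (Fin n)) i j
  exact ⟨g, hg⟩

/-! ### Upper bounds from points on a line -/

section AffineLine

/-- The alternating group of degree three acts faithfully on the field generated by the ratios of
the differences of three points of the affine line. -/
theorem ed_alternatingGroup_three_le (K : Type*) [Field K] :
    ed K (alternatingGroup (Fin 3)) ≤ 1 := by
  have htr := exists_alternatingGroup_apply_eq (n := 3) le_rfl 0
  set p := point K (alternatingGroup (Fin 3)).subtype 0 with hp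
  have hne : ∀ i j, i ≠ j → p i - p j ≠ 0 := fun i j hij ↦ sub_ne_zero.2 (point_ne_point htr hij)
  set S : Set (RegField K (alternatingGroup (Fin 3))) :=
    {x | ∃ i j k l, (p i - p j) / (p k - p l) = x} with hS
  have hsimple : IsSimpleGroup (alternatingGroup (Fin 3)) :=
    isSimpleGroup_of_prime_card (p := 3) (by
      rw [nat_card_alternatingGroup]; simp [Nat.factorial])
  have hstable := adjoin_stable (K := K) (ρ := regAction K (alternatingGroup (Fin 3))) (S := S) <| by
    rintro g _ ⟨i, j, k, l, rfl⟩
    exact ⟨g.1 i, g.1 j, g.1 k, g.1 l, by simp [hp, regAction_point]⟩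
  let g : alternatingGroup (Fin 3) := ⟨Equiv.swap 0 1 * Equiv.swap 1 2, Equiv.Perm.mem_alternatingGroup.2 (by decide)⟩
  have hcomp : Compresses (regAction K (alternatingGroup (Fin 3))) (adjoin K S) := by
    refine compresses_of_isSimpleGroup hstable (g := g)
      (subset_adjoin K S ⟨0, 1, 1, 2, rfl⟩) fun h ↦ ?_
    have hg : ∀ i, regAction K _ g (p i) = p (g.1 i) := fun i ↦ regAction_point _ _ i g
    rw [map_div₀, map_sub, map_sub, hg, hg, hg, show g.1 0 = 1 by decide,
      show g.1 1 = 2 by decide, show g.1 2 = 0 by decide,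
      div_eq_div_iff (hne _ _ (by decide)) (hne _ _ (by decide))] at h
    -- At the values 0, 1, 0 the left side is 1 and the right side is 0.
    have := aeval_eq_of_aeval_point_eq (K := K) htr
      (P := (.X 1 - .X 2) * (.X 1 - .X 2)) (Q := (.X 0 - .X 1) * (.X 2 - .X 0))
      (by simpa using h) ![0, 1, 0]
    simp at this
  refine ed_le_of_compresses hcomp ?_
  -- The affine map sending p 0 to 0 and p 1 to 1 leaves the ratios unchanged. Only the image of p 2
  -- remains as a parameter.
  have hmem : adjoin K S ≤ adjoin K {(p 2 - p 0) / (p 1 - p 0)} := by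
    set F := adjoin K {(p 2 - p 0) / (p 1 - p 0)} with hF
    rw [adjoin_le_iff]
    have h10 := hne 1 0 (by decide)
    have hv : ∀ i, (p i - p 0) / (p 1 - p 0) ∈ F := by
      intro i
      fin_cases i
      · simp
      · simp [h10]
      · exact subset_adjoin K _ rfl
    rintro _ ⟨i, j, k, l, rfl⟩
    have h : (p i - p j) / (p k - p l) =
        ((p i - p 0) / (p 1 - p 0) - (p j - p 0) / (p 1 - p 0)) /
          ((p k - p 0) / (p 1 - p 0) - (p l - p 0) / (p 1 - p 0)) := by
      rw [← sub_div, ← sub_div, div_div_div_cancel_right₀ h10, sub_sub_sub_cancel_right,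
        sub_sub_sub_cancel_right]
    rw [h]
    exact div_mem (sub_mem (hv i) (hv j)) (sub_mem (hv k) (hv l))
  exact (trdeg_le_of_le_adjoin hmem).trans (by simp)

end AffineLine

section ProjectiveLine

/-- The alternating group of degree five acts faithfully on the field generated by the cross-ratios
of five points of the projective line. -/
theorem ed_alternatingGroup_five_le (K : Type*) [Field K] :
    ed K (alternatingGroup (Fin 5)) ≤ 2 := by
  have htr := exists_alternatingGroup_apply_eq (n := 5) (by norm_num) 0
  set p := point K (alternatingGroup (Fin 5)).subtype 0 with hp
  have hne : ∀ i j, i ≠ j → p i - p j ≠ 0 := fun i j hij ↦ sub_ne_zero.2 (point_ne_point htr hij)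
  set S : Set (RegField K (alternatingGroup (Fin 5))) :=
    {x | ∃ i j k l, ((p i - p k) * (p j - p l)) / ((p i - p l) * (p j - p k)) = x} with hS
  have hsimple : IsSimpleGroup (alternatingGroup (Fin 5)) :=
    alternatingGroup.isSimpleGroup (by simp)
  have hstable := adjoin_stable (K := K) (ρ := regAction K (alternatingGroup (Fin 5))) (S := S) <| by
    rintro g _ ⟨i, j, k, l, rfl⟩
    exact ⟨g.1 i, g.1 j, g.1 k, g.1 l, by simp [hp, regAction_point]⟩
  let g : alternatingGroup (Fin 5) := ⟨Equiv.swap 2 3 * Equiv.swap 3 4, Equiv.Perm.mem_alternatingGroup.2 (by decide)⟩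
  have hcomp : Compresses (regAction K (alternatingGroup (Fin 5))) (adjoin K S) := by
    refine compresses_of_isSimpleGroup hstable (g := g)
      (subset_adjoin K S ⟨0, 1, 2, 3, rfl⟩) fun h ↦ ?_
    have hg : ∀ i, regAction K _ g (p i) = p (g.1 i) := fun i ↦ regAction_point _ _ i g
    rw [map_div₀, map_mul, map_mul, map_sub, map_sub, map_sub, map_sub, hg, hg, hg, hg,
      show g.1 0 = 0 by decide, show g.1 1 = 1 by decide, show g.1 2 = 3 by decide,
      show g.1 3 = 4 by decide,
      div_eq_div_iff (mul_ne_zero (hne _ _ (by decide)) (hne _ _ (by decide)))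
        (mul_ne_zero (hne _ _ (by decide)) (hne _ _ (by decide)))] at h
    -- At the values 0, 1, 1, 0, 1 the left side vanishes and the right side is 1.
    have := aeval_eq_of_aeval_point_eq (K := K) htr
      (P := ((.X 0 - .X 3) * (.X 1 - .X 4)) * ((.X 0 - .X 3) * (.X 1 - .X 2)))
      (Q := ((.X 0 - .X 2) * (.X 1 - .X 3)) * ((.X 0 - .X 4) * (.X 1 - .X 3)))
      (by simpa using h) ![0, 1, 1, 0, 1]
    simp at this
  refine ed_le_of_compresses hcomp ?_
  -- The scale w makes z ↦ w/(z − p 0) − w/(p 2 − p 0) send p 0, p 1, p 2 to ∞, 1, 0. The images of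
  -- p 3 and p 4 remain as parameters.
  obtain ⟨w, hw0, hw⟩ : ∃ w, w ≠ 0 ∧ w / (p 1 - p 0) - w / (p 2 - p 0) = 1 := by
    have h1 := hne 1 0 (by decide)
    have h2 := hne 2 0 (by decide)
    have h3 := hne 2 1 (by decide)
    refine ⟨(p 1 - p 0) * (p 2 - p 0) / (p 2 - p 1), div_ne_zero (mul_ne_zero h1 h2) h3, ?_⟩
    field_simp
    ring
  let t : Fin 5 → RegField K (alternatingGroup (Fin 5)) :=
    fun i ↦ w / (p i - p 0) - w / (p 2 - p 0)
  have hmem : adjoin K S ≤ adjoin K {t 3, t 4} := by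
    set F := adjoin K {t 3, t 4} with hF
    rw [adjoin_le_iff]
    have ht : ∀ i, i ≠ 0 → t i ∈ F := by
      intro i hi
      fin_cases i
      · exact absurd rfl hi
      · change w / (p 1 - p 0) - w / (p 2 - p 0) ∈ F
        rw [hw]
        exact one_mem F
      · change w / (p 2 - p 0) - w / (p 2 - p 0) ∈ F
        rw [sub_self]
        exact zero_mem F
      · exact subset_adjoin K _ (Or.inl rfl)
      · exact subset_adjoin K _ (Or.inr rfl)
    -- For i, j ≠ 0 the product w u_i u_j (p_i − p_j) is the difference t_j − t_i. The value of u at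
    -- 0 is chosen so that differences with the point sent to ∞ become ±1. Each u_i cancels in a
    -- cross-ratio.
    let u : Fin 5 → RegField K (alternatingGroup (Fin 5)) :=
      fun i ↦ if i = 0 then w⁻¹ else (p i - p 0)⁻¹
    have hu : ∀ i, u i ≠ 0 := fun i ↦ by
      by_cases hi : i = 0
      · simp [u, hi, hw0]
      · simp [u, hi, hne i 0 hi]
    have hd : ∀ i j, w * (u i * u j) * (p i - p j) ∈ F := by
      intro i j
      by_cases hi : i = 0 <;> by_cases hj : j = 0
      · simp [hi, hj]
      · have h := hne j 0 hj
        have : w * (u i * u j) * (p i - p j) = -1 := by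
          simp only [u, hi, hj, if_true, if_false]
          field_simp
          ring
        rw [this]
        exact neg_mem (one_mem F)
      · have h := hne i 0 hi
        have : w * (u i * u j) * (p i - p j) = 1 := by
          simp only [u, hi, hj, if_true, if_false]
          field_simp
        rw [this]
        exact one_mem F
      · have h := hne i 0 hi
        have h' := hne j 0 hj
        have : w * (u i * u j) * (p i - p j) = t j - t i := by
          simp only [u, t, hi, hj, if_false, sub_sub_sub_cancel_right]
          field_simp
          ring
        rw [this]
        exact sub_mem (ht j hj) (ht i hi)
    rintro _ ⟨i, j, k, l, rfl⟩
    have h : ((p i - p k) * (p j - p l)) / ((p i - p l) * (p j - p k)) =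
        ((w * (u i * u k) * (p i - p k)) * (w * (u j * u l) * (p j - p l))) /
          ((w * (u i * u l) * (p i - p l)) * (w * (u j * u k) * (p j - p k))) := by
      have hc : w * w * (u i * u j * u k * u l) ≠ 0 :=
        mul_ne_zero (mul_ne_zero hw0 hw0)
          (mul_ne_zero (mul_ne_zero (mul_ne_zero (hu i) (hu j)) (hu k)) (hu l))
      rw [← mul_div_mul_left _ _ hc]
      congr 1 <;> ring
    rw [h]
    exact div_mem (mul_mem (hd _ _) (hd _ _)) (mul_mem (hd _ _) (hd _ _))
  refine (trdeg_le_of_le_adjoin hmem).trans ?_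
  exact (Cardinal.mk_insert_le).trans (by rw [Cardinal.mk_singleton]; norm_num)

end ProjectiveLine
end EssDim

namespace EssDim

/-! ### Subgroups of alternating groups -/

section Groups

open Equiv.Perm

/-- The product of the alternating groups of degrees `m` and `n` as a subgroup of the alternating
group of degree `m + n`. -/
def alternatingProd (m n : ℕ) : alternatingGroup (Fin m) × alternatingGroup (Fin n) →*
    alternatingGroup (Fin (m + n)) where
  toFun g := ⟨finSumFinEquiv.permCongr (sumCongr g.1.1 g.2.1), by
    rw [mem_alternatingGroup, sign_permCongr, sign_sumCongr, mem_alternatingGroup.1 g.1.2,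
      mem_alternatingGroup.1 g.2.2, one_mul]⟩
  map_one' := by
    ext x
    simp
  map_mul' g h := by
    ext x
    simp [Equiv.permCongr_apply, ← Equiv.Perm.sumCongr_mul]

theorem alternatingProd_injective (m n : ℕ) : Function.Injective (alternatingProd m n) := by
  intro g h hgh
  have h1 := finSumFinEquiv.permCongr.injective (congrArg Subtype.val hgh)
  have h2 := sumCongrHom_injective (a₁ := (g.1.1, g.2.1)) (a₂ := (h.1.1, h.2.1)) h1
  rw [Prod.mk.injEq] at h2
  exact Prod.ext (Subtype.ext h2.1) (Subtype.ext h2.2)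

/-- The Klein four-group as a group of even permutations of four elements. -/
theorem exists_injective_klein_alternatingGroup_four :
    ∃ φ : ℤˣ × ℤˣ →* alternatingGroup (Fin 4), Function.Injective φ := by
  -- In the regular action a nontrivial element is a product of two disjoint transpositions.
  have hs : ∀ g : ℤˣ × ℤˣ, Equiv.Perm.sign (MulAction.toPerm g : Equiv.Perm (ℤˣ × ℤˣ)) = 1 := by
    decide
  let e : ℤˣ × ℤˣ ≃ Fin 4 := Fintype.equivOfCardEq (by decide)
  refine ⟨{ toFun := fun g ↦ ⟨e.permCongr (MulAction.toPerm g), by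
              rw [mem_alternatingGroup, sign_permCongr, hs]⟩
            map_one' := ?_
            map_mul' := ?_ }, ?_⟩
  · ext x
    simp
  · intro g h
    ext x
    simp [Equiv.permCongr_apply, mul_assoc]
  · intro g h hgh
    have h1 := e.permCongr.injective (congrArg Subtype.val hgh)
    exact MulAction.toPerm_injective h1

theorem isSimpleGroup_alternatingGroup {n : ℕ} (hn : 5 ≤ n) :
    IsSimpleGroup (alternatingGroup (Fin n)) :=
  alternatingGroup.isSimpleGroup (by simpa using hn)

theorem subsingleton_alternatingGroup {n : ℕ} (hn : n ≤ 2) :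
    Subsingleton (alternatingGroup (Fin n)) := by
  interval_cases n
  · infer_instance
  · infer_instance
  · refine ⟨fun a b ↦ Subtype.ext ?_⟩
    have : ∀ a : Equiv.Perm (Fin 2), Equiv.Perm.sign a = 1 → a = 1 := by decide
    rw [this a.1 (mem_alternatingGroup.1 a.2), this b.1 (mem_alternatingGroup.1 b.2)]

theorem eq_one_of_mem_center_alternatingGroup {n : ℕ} (hn : n ≠ 3) {z : alternatingGroup (Fin n)}
    (hz : z ∈ Subgroup.center (alternatingGroup (Fin n))) : z = 1 := by
  rcases le_or_gt n 2 with h | h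
  · have := subsingleton_alternatingGroup h
    exact Subsingleton.elim _ _
  · rwa [alternatingGroup.center_eq_bot (by simp; omega), Subgroup.mem_bot] at hz

set_option maxRecDepth 20000 in
/-- A nontrivial normal subgroup of an alternating group of degree other than three contains
involutions. -/
theorem exists_orderOf_eq_two {n : ℕ} (hn : n ≠ 3) {W : Subgroup (alternatingGroup (Fin n))}
    (hW : W.Normal) (hW' : W ≠ ⊥) : ∃ w ∈ W, orderOf w = 2 := by
  have key : ∀ w ∈ W, w ≠ 1 → w.1 ^ 2 = 1 → ∃ w ∈ W, orderOf w = 2 := fun w hw hw1 hw2 ↦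
    ⟨w, hw, orderOf_eq_prime (Subtype.ext hw2) hw1⟩
  obtain ⟨⟨g, hg⟩, hg1⟩ := Subgroup.ne_bot_iff_exists_ne_one.1 hW'
  have hg1 : g ≠ 1 := fun h ↦ hg1 (Subtype.ext h)
  have hdeg : n ≤ 2 ∨ n = 4 ∨ 5 ≤ n := by omega
  rcases hdeg with h | rfl | h
  · have := subsingleton_alternatingGroup h
    exact absurd (Subsingleton.elim _ _) hg1
  · have hdec : ∀ g : Equiv.Perm (Fin 4), Equiv.Perm.sign g = 1 → g ≠ 1 →
        ∃ h : Equiv.Perm (Fin 4), Equiv.Perm.sign h = 1 ∧ g * (h * g⁻¹ * h⁻¹) ≠ 1 ∧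
          (g * (h * g⁻¹ * h⁻¹)) ^ 2 = 1 := by
      decide
    obtain ⟨h, hh, h1, h2⟩ := hdec g.1 (mem_alternatingGroup.1 g.2) fun h ↦ hg1 (Subtype.ext h)
    let h' : alternatingGroup (Fin 4) := ⟨h, mem_alternatingGroup.2 hh⟩
    exact key (g * (h' * g⁻¹ * h'⁻¹))
      (W.mul_mem hg (hW.conj_mem _ (W.inv_mem hg) h')) (fun h ↦ h1 (congrArg Subtype.val h)) h2
  · have := isSimpleGroup_alternatingGroup h
    have htop := (hW.eq_bot_or_eq_top).resolve_left hW'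
    obtain ⟨φ, hφ⟩ := exists_injective_klein_alternatingGroup_four
    obtain ⟨k, rfl⟩ : ∃ k, n = k + 4 := ⟨n - 4, by omega⟩
    let ψ := (alternatingProd k 4).comp ((MonoidHom.inr _ _).comp φ)
    have hψ : Function.Injective ψ := (alternatingProd_injective k 4).comp
      ((Prod.mk_right_injective 1).comp hφ)
    refine ⟨ψ (-1, 1), htop ▸ Subgroup.mem_top _, ?_⟩
    rw [orderOf_injective ψ hψ]
    exact orderOf_eq_prime (by decide) (by decide)

/-- A nontrivial normal subgroup of an alternating group of degree other than four contains elements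
of order three. -/
theorem exists_orderOf_eq_three {n : ℕ} (hn : n ≠ 4) {W : Subgroup (alternatingGroup (Fin n))}
    (hW : W.Normal) (hW' : W ≠ ⊥) : ∃ w ∈ W, orderOf w = 3 := by
  obtain ⟨⟨g, hg⟩, hg1⟩ := Subgroup.ne_bot_iff_exists_ne_one.1 hW'
  have hg1 : g ≠ 1 := fun h ↦ hg1 (Subtype.ext h)
  have hdeg : n ≤ 2 ∨ n = 3 ∨ 5 ≤ n := by omega
  rcases hdeg with h | rfl | h
  · have := subsingleton_alternatingGroup h
    exact absurd (Subsingleton.elim _ _) hg1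
  · have hcard : Nat.card (alternatingGroup (Fin 3)) = 3 := by
      rw [nat_card_alternatingGroup]; simp [Nat.factorial]
    have hpow := pow_card_eq_one' (x := g)
    rw [hcard] at hpow
    exact ⟨g, hg, orderOf_eq_prime hpow hg1⟩
  · have := isSimpleGroup_alternatingGroup h
    have htop := (hW.eq_bot_or_eq_top).resolve_left hW'
    obtain ⟨k, rfl⟩ : ∃ k, n = 3 + k := ⟨n - 3, by omega⟩
    let c : alternatingGroup (Fin 3) :=
      ⟨Equiv.swap 0 1 * Equiv.swap 1 2, mem_alternatingGroup.2 (by decide)⟩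
    let ψ := (alternatingProd 3 k).comp (MonoidHom.inl _ _)
    have hψ : Function.Injective ψ := (alternatingProd_injective 3 k).comp
      (Prod.mk_left_injective 1)
    refine ⟨ψ c, htop ▸ Subgroup.mem_top _, ?_⟩
    rw [orderOf_injective ψ hψ]
    exact orderOf_eq_prime (Subtype.ext (by decide)) fun h ↦
      absurd (congrArg Subtype.val h) (by decide)

/-- This lets the product inequality be iterated. If W projects trivially to G, element orders
divide |C|; otherwise a lift has order dividing |C| times the order of its projection. -/
theorem exists_orderOf_ne_zero_prod {K G C : Type*} [Field K] [Group G] [Group C]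
    (hC : (Nat.card C : K) ≠ 0)
    (hG : ∀ W : Subgroup G, W.Normal → W ≠ ⊥ → ∃ w ∈ W, w ≠ 1 ∧ (orderOf w : K) ≠ 0)
    (W : Subgroup (G × C)) (hW : W.Normal) (hW' : W ≠ ⊥) :
    ∃ w ∈ W, w ≠ 1 ∧ (orderOf w : K) ≠ 0 := by
  by_cases h : W.map (MonoidHom.fst G C) = ⊥
  · obtain ⟨⟨w, hw⟩, hw1⟩ := Subgroup.ne_bot_iff_exists_ne_one.1 hW'
    refine ⟨w, hw, fun h ↦ hw1 (Subtype.ext h), fun h0 ↦ hC ?_⟩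
    have h1 : w.1 = 1 := by
      have : w.1 ∈ W.map (MonoidHom.fst G C) := ⟨w, hw, rfl⟩
      rwa [h, Subgroup.mem_bot] at this
    obtain ⟨k, hk⟩ : orderOf w ∣ Nat.card C := orderOf_dvd_of_pow_eq_one <|
      Prod.ext (by simp [h1]) pow_card_eq_one'
    rw [hk, Nat.cast_mul, h0, zero_mul]
  · obtain ⟨_, ⟨w, hw, rfl⟩, hw1, hw2⟩ := hG _ (hW.map _ Prod.fst_surjective) h
    refine ⟨w, hw, fun h ↦ hw1 (by rw [h, map_one]), fun h0 ↦ mul_ne_zero hw2 hC ?_⟩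
    obtain ⟨k, hk⟩ : orderOf w ∣ orderOf (MonoidHom.fst G C w) * Nat.card C :=
      orderOf_dvd_of_pow_eq_one <| Prod.ext
        (by
          rw [Prod.pow_fst, pow_mul]
          exact (congrArg (· ^ Nat.card C) (pow_orderOf_eq_one w.1)).trans (one_pow _))
        (by rw [Prod.pow_snd, mul_comm, pow_mul, pow_card_eq_one', one_pow]; rfl)
    rw [← Nat.cast_mul, hk, Nat.cast_mul, h0, zero_mul]

end Groups

/-! ### Lower bounds for alternating groups -/

section Alternating

variable {K : Type*} [Field K]

theorem ed_alternatingGroup_le_add (m n : ℕ) :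
    ed K (alternatingGroup (Fin m)) ≤ ed K (alternatingGroup (Fin (m + n))) :=
  ed_le_of_injective ((alternatingProd m n).comp (MonoidHom.inl _ _))
    ((alternatingProd_injective m n).comp (Prod.mk_left_injective 1))

theorem ed_alternatingGroup_add_two_le (hK : (2 : K) ≠ 0) {n : ℕ} (hn : n ≠ 3) :
    ed K (alternatingGroup (Fin n)) + 2 ≤ ed K (alternatingGroup (Fin (n + 4))) := by
  have hcard : Nat.card ℤˣ = 2 := by simp
  have hC : (Nat.card ℤˣ : K) ≠ 0 := by rw [hcard]; exact_mod_cast hK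
  have : Nontrivial ℤˣ := ⟨1, -1, by decide⟩
  have hχ : Function.Injective (Units.map (Int.castRingHom K : ℤ →* K)) := by
    intro a b hab
    have h1 : (1 : K) ≠ -1 := fun h ↦ hK (by linear_combination h)
    have h2 := congrArg Units.val hab
    rcases Int.units_eq_one_or a with rfl | rfl <;> rcases Int.units_eq_one_or b with rfl | rfl
    · rfl
    · exact absurd (by simpa using h2) h1
    · exact absurd (by simpa using h2.symm) h1
    · rfl
  have hsq : ∀ u : ℤˣ, u ^ Nat.card ℤˣ = 1 := fun u ↦ pow_card_eq_one'
  have hG : ∀ W : Subgroup (alternatingGroup (Fin n)), W.Normal → W ≠ ⊥ →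
      ∃ w ∈ W, w ≠ 1 ∧ (orderOf w : K) ≠ 0 := fun W hW hW' ↦ by
    obtain ⟨w, hw, hw2⟩ := exists_orderOf_eq_two hn hW hW'
    refine ⟨w, hw, fun h ↦ ?_, by rw [hw2]; exact_mod_cast hK⟩
    rw [h, orderOf_one] at hw2
    omega
  have h1 := ed_add_one_le_ed_prod hχ hC (G := alternatingGroup (Fin n))
    (fun z hz ↦ by rw [eq_one_of_mem_center_alternatingGroup hn hz, one_pow]) hG
  -- The second factor {±1} is split off from A_n × {±1}, whose centre is killed by 2.
  have h2 := ed_add_one_le_ed_prod hχ hC (G := alternatingGroup (Fin n) × ℤˣ)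
    (fun z hz ↦ by
      have hz1 : z.1 ∈ Subgroup.center (alternatingGroup (Fin n)) := by
        rw [Subgroup.mem_center_iff] at hz ⊢
        exact fun g ↦ congrArg Prod.fst (hz (g, 1))
      refine Prod.ext ?_ (hsq z.2)
      rw [Prod.pow_fst, eq_one_of_mem_center_alternatingGroup hn hz1, one_pow]
      rfl)
    (exists_orderOf_ne_zero_prod hC hG)
  obtain ⟨φ, hφ⟩ := exists_injective_klein_alternatingGroup_four
  have h3 := ed_le_of_injective (K := K) ((alternatingProd n 4).comp
    (((MonoidHom.id (alternatingGroup (Fin n))).prodMap φ).comp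
      (MulEquiv.prodAssoc : (alternatingGroup (Fin n) × ℤˣ) × ℤˣ ≃* _).toMonoidHom))
    ((alternatingProd_injective n 4).comp
      ((Function.injective_id.prodMap hφ).comp (MulEquiv.injective _)))
  omega

/-- Here C = F₄ˣ is isomorphic to A_3. Degree 3 is allowed because the centre of A_3 is killed by 3.
In degree 4 the Klein subgroup has no nontrivial element of order invertible in characteristic 2. -/
theorem ed_alternatingGroup_add_one_le (f : GaloisField 2 2 →+* K) {n : ℕ} (hn : n ≠ 4) :
    ed K (alternatingGroup (Fin n)) + 1 ≤ ed K (alternatingGroup (Fin (n + 3))) := by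
  have h2 : (2 : K) = 0 := by
    have : (2 : GaloisField 2 2) = 0 := CharP.cast_eq_zero (GaloisField 2 2) 2
    rw [← map_ofNat f 2, this, map_zero]
  have h3 : (3 : K) ≠ 0 := by
    have : (3 : K) = 1 := by linear_combination h2
    rw [this]
    exact one_ne_zero
  have hcard : Nat.card (GaloisField 2 2)ˣ = 3 := by
    rw [Nat.card_units, GaloisField.card 2 2 two_ne_zero]
    norm_num
  have : Finite (GaloisField 2 2)ˣ := Nat.finite_of_card_ne_zero (by omega)
  have : Nontrivial (GaloisField 2 2)ˣ := Finite.one_lt_card_iff_nontrivial.1 (by omega)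
  have hC : (Nat.card (GaloisField 2 2)ˣ : K) ≠ 0 := by rw [hcard]; exact_mod_cast h3
  have hcard3 : Nat.card (alternatingGroup (Fin 3)) = 3 := by
    rw [nat_card_alternatingGroup]; simp [Nat.factorial]
  have h1 := ed_add_one_le_ed_prod (χ := Units.map (f : GaloisField 2 2 →* K))
    (Units.map_injective f.injective) hC (G := alternatingGroup (Fin n))
    (fun z hz ↦ by
      rw [hcard]
      rcases eq_or_ne n 3 with rfl | hn3
      · have hpow := pow_card_eq_one' (x := z)
        rwa [hcard3] at hpow
      · rw [eq_one_of_mem_center_alternatingGroup hn3 hz, one_pow])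
    (fun W hW hW' ↦ by
      obtain ⟨w, hw, hw3⟩ := exists_orderOf_eq_three hn hW hW'
      refine ⟨w, hw, fun h ↦ ?_, by rw [hw3]; exact_mod_cast h3⟩
      rw [h, orderOf_one] at hw3
      omega)
  have : Fact (Nat.Prime 3) := ⟨Nat.prime_three⟩
  let e : (GaloisField 2 2)ˣ ≃* alternatingGroup (Fin 3) := mulEquivOfPrimeCardEq hcard hcard3
  have h4 := ed_le_of_injective (K := K) ((alternatingProd n 3).comp
    ((MonoidHom.id (alternatingGroup (Fin n))).prodMap e.toMonoidHom))
    ((alternatingProd_injective n 3).comp (Function.injective_id.prodMap e.injective))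
  omega

theorem two_mul_div_four_le_ed (hK : (2 : K) ≠ 0) (n : ℕ) :
    2 * (n / 4) ≤ ed K (alternatingGroup (Fin n)) := by
  induction n using Nat.strong_induction_on with
  | _ n ih =>
    rcases lt_or_ge n 4 with h | h
    · omega
    obtain ⟨k, rfl⟩ : ∃ k, n = k + 4 := ⟨n - 4, by omega⟩
    -- For n = 7 the bound 2⌊n/4⌋ is the same as for n = 6.
    rcases eq_or_ne k 3 with rfl | hk
    · exact (ih 6 (by omega)).trans (ed_alternatingGroup_le_add 6 1)
    · have h1 := ih k (by omega)
      have h2 := ed_alternatingGroup_add_two_le hK hk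
      omega

theorem div_three_le_ed_of_ringHom (f : GaloisField 2 2 →+* K) (n : ℕ) :
    n / 3 ≤ ed K (alternatingGroup (Fin n)) := by
  induction n using Nat.strong_induction_on with
  | _ n ih =>
    rcases lt_or_ge n 3 with h | h
    · omega
    obtain ⟨k, rfl⟩ : ∃ k, n = k + 3 := ⟨n - 3, by omega⟩
    -- For n = 7 the bound ⌊n/3⌋ is the same as for n = 6.
    rcases eq_or_ne k 4 with rfl | hk
    · exact (ih 6 (by omega)).trans (ed_alternatingGroup_le_add 6 1)
    · have h1 := ih k (by omega)
      have h2 := ed_alternatingGroup_add_one_le f hk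
      omega

/-- The algebraic closure of K contains F₄, and a lower bound over an extension field holds over K.
-/
theorem div_three_le_ed [CharP K 2] (n : ℕ) : n / 3 ≤ ed K (alternatingGroup (Fin n)) := by
  have : CharP (AlgebraicClosure K) 2 := charP_of_injective_algebraMap
    (algebraMap K (AlgebraicClosure K)).injective 2
  let _ : Algebra (ZMod 2) (AlgebraicClosure K) := ZMod.algebra _ 2
  have f : GaloisField 2 2 →ₐ[ZMod 2] AlgebraicClosure K := IsAlgClosed.lift
  exact (div_three_le_ed_of_ringHom f.toRingHom n).trans (ed_le_ed_of_algebra K (AlgebraicClosure K))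

end Alternating

end EssDim

theorem theorem5p6 (K : Type*) [Field K] :
    (ringChar K ≠ 2 →
      EssDim.ed K (alternatingGroup (Fin 3)) = 1 ∧
      EssDim.ed K (alternatingGroup (Fin 4)) = 2 ∧
      EssDim.ed K (alternatingGroup (Fin 5)) = 2 ∧
      (∀ n : ℕ, 4 ≤ n →
        EssDim.ed K (alternatingGroup (Fin n)) + 2 ≤
          EssDim.ed K (alternatingGroup (Fin (n + 4)))) ∧
      (∀ n : ℕ, 2 * (n / 4) ≤ EssDim.ed K (alternatingGroup (Fin n)))) ∧
    (Nonempty (GaloisField 2 2 →+* K) →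
      ∀ n : ℕ, n ≠ 4 →
        EssDim.ed K (alternatingGroup (Fin n)) + 1 ≤
          EssDim.ed K (alternatingGroup (Fin (n + 3)))) ∧
    (ringChar K = 2 →
      ∀ n : ℕ, n / 3 ≤ EssDim.ed K (alternatingGroup (Fin n))) := by
  refine ⟨fun hK ↦ ?_, fun ⟨f⟩ n hn ↦ EssDim.ed_alternatingGroup_add_one_le f hn, fun hK n ↦ ?_⟩
  · have h2 : (2 : K) ≠ 0 := Ring.two_ne_zero hK
    have h4 := EssDim.two_mul_div_four_le_ed h2 4
    have h45 := EssDim.ed_alternatingGroup_le_add (K := K) 4 1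
    have h5 := EssDim.ed_alternatingGroup_five_le K
    have : Nontrivial (alternatingGroup (Fin 3)) := Finite.one_lt_card_iff_nontrivial.1 (by
      rw [nat_card_alternatingGroup]; simp [Nat.factorial])
    exact ⟨le_antisymm (EssDim.ed_alternatingGroup_three_le K) EssDim.one_le_ed,
      le_antisymm (h45.trans h5) h4, le_antisymm h5 (h4.trans h45),
      fun n hn ↦ EssDim.ed_alternatingGroup_add_two_le h2 (by omega),
      EssDim.two_mul_div_four_le_ed h2⟩
  · have : CharP K 2 := ringChar.of_eq hK
    exact EssDim.div_three_le_ed n
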